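/- **Setting.** Let $d\ge 1$, let $\Omega\subset\mathbb R^d$ be open and bounded with $\mathscr L^d(\partial\Omega)=0$, let $Z=\mathbb R^d/\mathbb Z^d$, and let $E,F$ be finite-dimensional Euclidean spaces. Let $\mathcal A=\sum_{|\alpha|=k}A_\alpha\partial^\alpha$, $A_\alpha\in\mathrm{Lin}(E;F)$, be a homogeneous constant-coefficient operator of order $k$ on $\mathbb R^d$, with formal adjoint $\mathcal A^*=(-1)^k\sum_{|\alpha|=k}A_\alpha^T\partial^\alpha$, and let $1<p<\frac d{d-1}$ (that is, $1<p<\infty$ if $d=1$). *Young measures.* A two-scale\* Young measure $\boldsymbol\nu=(\nu,\lambda,\rho,\nu^\infty)\in\mathbf Y^2(\Omega;E)$ consists of a finite positive measure $\lambda$ on $\overline\Omega$ and weak-\* measurable families of probability measures $\nu_{x,\xi}$ on $E$, $\rho_x$ on $Z$ (defined $\lambda$-a.e.) and $\nu^\infty_{x,\xi}$ on the unit sphere of $E$ (defined $(\lambda\otimes\rho_x)$-a.e.), where $(x,\xi)\in\overline\Omega\times Z$ and $\int_{\Omega}\int_Z\int_E|z|\,d\nu_{x,\xi}(z)\,d\xi\,dx<\infty$.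 Let $\mathbf E^2(\Omega;E)$ be the set of all continuous $f:\Omega\times Z\times E\to\mathbb R$ such that $(x,\xi,\hat z)\mapsto(1-|\hat z|)f(x,\xi,\hat z/(1-|\hat z|))$, $|\hat z|<1$, extends continuously to $\overline\Omega\times Z\times\{|\hat z|\le1\}$, and let $f^\infty(x,\xi,z)=\lim f(x',\xi',tz)/t$ as $x'\to x$, $\xi'\to\xi$, $t\to\infty$. A sequence of $E$-valued measures $\mu_j=\mu_j^{ac}\mathscr L^d+(\mu_j)_s|\mu_j^s|$ on $\Omega$ (Lebesgue decomposition, with polar density $(\mu_j)_s$) *generates* $\boldsymbol\nu$ along positive scales $\epsilon_j\to0$ if for all $f\in\mathbf E^2(\Omega;E)$ $$\int_\Omega f\big(x,\tfrac x{\epsilon_j},\mu_j^{ac}(x)\big)dx+\int_\Omega f^\infty\big(x,\tfrac x{\epsilon_j},(\mu_j)_s(x)\big)d|\mu_j^s|(x)\ \longrightarrow\ \int_\Omega\int_Z\int_E f\,d\nu_{x,\xi}\,d\xi\,dx+\int_{\overline\Omega}\int_Z\int f^\infty\,d\nu^\infty_{x,\xi}\,d\rho_x(\xi)\,d\lambda(x).$$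 $\boldsymbol\nu$ is *$\mathcal A$-free* if there are such $\epsilon_j$ and $\mu_j$ generating $\boldsymbol\nu$ with $\mathcal A\mu_j\to0$ strongly in $W^{-k,p}(\Omega)=(W^{k,p'}_0(\Omega;F))^*$, $\frac1p+\frac1{p'}=1$. *Second-scale barycenter.* Write $\lambda=\lambda^{ac}\mathscr L^d+\lambda^s$ for the Lebesgue decomposition and let $\overline\Omega=\mathrm{Reg}\cup\mathrm{Sing}$ be any Borel partition with $\mathscr L^d(\mathrm{Sing})=\lambda^s(\mathrm{Reg})=0$. For Borel $V\subset Z$, $$\langle\langle\boldsymbol\nu\rangle\rangle_x(V)=\begin{cases}\displaystyle\int_V\int_E z\,d\nu_{x,\xi}(z)\,d\xi+\lambda^{ac}(x)\int_V\int z\,d\nu^\infty_{x,\xi}(z)\,d\rho_x(\xi),&x\in\mathrm{Reg},\\[2mm]\displaystyle\int_V\int z\,d\nu^\infty_{x,\xi}(z)\,d\rho_x(\xi),&x\in\mathrm{Sing}.\end{cases}$$ **Proposition.** If $\boldsymbol\nu\in\mathbf Y^2(\Omega;E)$ is $\mathcal A$-free, then for $(\mathscr L^d+\lambda^s)$-almost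 every $x_0\in\Omega$ the $E$-valued measure $\langle\langle\boldsymbol\nu\rangle\rangle_{x_0}$ on $Z$ is $\mathcal A$-free in the sense of distributions on $Z$: $$\int_Z\mathcal A^*g\cdot d\langle\langle\boldsymbol\nu\rangle\rangle_{x_0}=0\qquad\text{for all smooth }\mathbb Z^d\text{-periodic }g:\mathbb R^d\to F.$$ -/

import Mathlib

open MeasureTheory ProbabilityTheory Filter Topology Set
open scoped ENNReal ContDiff Distributions

noncomputable section

namespace TwoScale

/-! ### The Euclidean space, the flat torus, and differential operators -/

/-- The Euclidean space `ℝ^d`. -/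
abbrev Space (d : ℕ) := EuclideanSpace ℝ (Fin d)

/-- The flat torus `Z = ℝ^d / ℤ^d`; its `volume` is the Lebesgue measure, of total mass one. -/
abbrev Torus (d : ℕ) := UnitAddTorus (Fin d)

/-- The quotient map `ℝ^d → Z`. -/
def toTorus {d : ℕ} (x : Space d) : Torus d := fun i => (x i : UnitAddCircle)

/-- The representative in `[0,1)^d` of a point of the torus. -/
def torusRep {d : ℕ} (ξ : Torus d) : Space d :=
  WithLp.toLp 2 fun i => (AddCircle.equivIco (1 : ℝ) 0 (ξ i) : ℝ)

/-- `ℤ^d`-periodicity of a function on `ℝ^d`. -/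
def IsPeriodic {d : ℕ} {F : Type*} (g : Space d → F) : Prop :=
  ∀ (m : Fin d → ℤ) (x : Space d), g (x + WithLp.toLp 2 fun i => (m i : ℝ)) = g x

/-- The partial derivative `∂_i φ`. -/
def partialDeriv {d : ℕ} {F : Type*} [NormedAddCommGroup F] [NormedSpace ℝ F]
    (i : Fin d) (φ : Space d → F) : Space d → F :=
  fun x => fderiv ℝ φ x (EuclideanSpace.single i (1 : ℝ))

/-- `∂^α φ = ∂_1^{α_1} ⋯ ∂_d^{α_d} φ` for a multi-index `α`. -/
def multiDeriv {d : ℕ} {F : Type*} [NormedAddCommGroup F] [NormedSpace ℝ F]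
    (α : Fin d → ℕ) (φ : Space d → F) : Space d → F :=
  (List.finRange d).foldr (fun i ψ => (partialDeriv i)^[α i] ψ) φ

/-- The finite set of multi-indices `α ∈ ℕ^d` with `|α| = k`. -/
def multiIndices (d k : ℕ) : Finset (Fin d → ℕ) := Finset.piAntidiag Finset.univ k

/-- The formal adjoint `𝒜^* φ = (-1)^k ∑_{|α| = k} A_α^T ∂^α φ` of the homogeneous operator
`𝒜 = ∑_{|α| = k} A_α ∂^α` of order `k`. Only the coefficients with `|α| = k` are used. -/
def adjointOp {d : ℕ} {E F : Type*}
    [NormedAddCommGroup E] [InnerProductSpace ℝ E] [FiniteDimensional ℝ E]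
    [NormedAddCommGroup F] [InnerProductSpace ℝ F] [FiniteDimensional ℝ F]
    (k : ℕ) (A : (Fin d → ℕ) → E →ₗ[ℝ] F) (φ : Space d → F) : Space d → E :=
  fun x => (-1 : ℝ) ^ k • ∑ α ∈ multiIndices d k, LinearMap.adjoint (A α) (multiDeriv α φ x)

/-! ### Vector measures as distributions -/

/-- The pairing `∫ ψ · dη` of an `E`-valued function with an `E`-valued measure. -/
def pairing {X E : Type*} [MeasurableSpace X] [NormedAddCommGroup E] [InnerProductSpace ℝ E]
    (ψ : X → E) (η : VectorMeasure X E) : ℝ :=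
  η.integral ψ (innerSL ℝ)

/-- The action `(𝒜μ)[φ] = ∫ 𝒜^*φ · dμ` of the distribution `𝒜μ` on test functions on `Ω`. -/
def opMeasure {d : ℕ} {E F : Type*}
    [NormedAddCommGroup E] [InnerProductSpace ℝ E] [FiniteDimensional ℝ E]
    [NormedAddCommGroup F] [InnerProductSpace ℝ F] [FiniteDimensional ℝ F]
    (k : ℕ) (A : (Fin d → ℕ) → E →ₗ[ℝ] F) (Ω : TopologicalSpace.Opens (Space d))
    (μ : VectorMeasure (Space d) E) (φ : 𝓓(Ω, F)) : ℝ :=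
  pairing (adjointOp k A φ) μ

/-- `𝒜_ξ η = 0` in the sense of distributions on the torus `Z`: `∫_Z 𝒜^*g · dη = 0` for every
smooth `ℤ^d`-periodic `g`. Since `𝒜^*g` is again periodic, it is a function on the torus, which is
evaluated at the representative in `[0,1)^d`. -/
def IsAFreeOnTorus {d : ℕ} {E F : Type*}
    [NormedAddCommGroup E] [InnerProductSpace ℝ E] [FiniteDimensional ℝ E]
    [NormedAddCommGroup F] [InnerProductSpace ℝ F] [FiniteDimensional ℝ F]
    (k : ℕ) (A : (Fin d → ℕ) → E →ₗ[ℝ] F) (η : VectorMeasure (Torus d) E) : Prop :=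
  ∀ g : Space d → F, ContDiff ℝ ∞ g → IsPeriodic g →
    pairing (fun ξ => adjointOp k A g (torusRep ξ)) η = 0

/-- The norm `∑_{|α| ≤ k} ‖∂^α φ‖_{L^q(Ω)}` of `W^{k,q}(Ω; F)`, on test functions. -/
def sobolevNorm {d : ℕ} {F : Type*} [NormedAddCommGroup F] [NormedSpace ℝ F]
    (k : ℕ) (q : ℝ≥0∞) (Ω : TopologicalSpace.Opens (Space d)) (φ : 𝓓(Ω, F)) : ℝ≥0∞ :=
  ∑ j ∈ Finset.range (k + 1), ∑ α ∈ multiIndices d j,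
    eLpNorm (multiDeriv α φ) q (volume.restrict (Ω : Set (Space d)))

/-- The norm of `W^{-k,p}(Ω; F) = (W_0^{k,p'}(Ω; F))^*`, where `1/p + 1/p' = 1`, of a functional
on test functions. It is `∞` if the functional does not extend continuously to `W_0^{k,p'}`. -/
def negSobolevNorm {d : ℕ} {F : Type*} [NormedAddCommGroup F] [NormedSpace ℝ F]
    (k : ℕ) (p : ℝ) (Ω : TopologicalSpace.Opens (Space d)) (T : 𝓓(Ω, F) → ℝ) : ℝ≥0∞ :=
  ⨆ (φ : 𝓓(Ω, F)) (_ : sobolevNorm k (ENNReal.ofReal (p / (p - 1))) Ω φ ≤ 1), ‖T φ‖ₑ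

/-- The Radon–Nikodým–Lebesgue decomposition `μ = μ^{ac} ℒ^d + μ_s |μ^s|` of an `E`-valued
measure, with `|μ^s| ⊥ ℒ^d` and `|μ_s| = 1`. It exists for each `E`-valued measure when `E` is
finite-dimensional, and is unique up to null sets. -/
structure LebesgueDecomposition {d : ℕ} {E : Type*}
    [NormedAddCommGroup E] [InnerProductSpace ℝ E]
    (μ : VectorMeasure (Space d) E) where
  /-- the density `μ^{ac}` -/
  ac : Space d → E
  /-- the total variation `|μ^s|` of the singular part -/
  singVar : Measure (Space d)
  /-- the polar density `μ_s` of the singular part -/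
  polar : Space d → E
  integrable_ac : Integrable ac volume
  finite_singVar : IsFiniteMeasure singVar
  singular : singVar ⟂ₘ volume
  measurable_polar : AEStronglyMeasurable polar singVar
  norm_polar : ∀ᵐ x ∂singVar, ‖polar x‖ = 1
  eq_add : μ = volume.withDensityᵥ ac + singVar.withDensityᵥ polar

/-! ### Integrands -/

/-- The class of integrands `f : Ω × Z × E → ℝ` that are continuous and for which
`(Tf)(x,ξ,ẑ) = (1 - |ẑ|) f(x, ξ, ẑ / (1 - |ẑ|))`, `|ẑ| < 1`, extends to a continuous function on
the closure of `Ω × Z × 𝔹_E`. The values of `f` at `x ∉ Ω` are irrelevant. -/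
structure IsIntegrand {d : ℕ} {E : Type*} [NormedAddCommGroup E] [InnerProductSpace ℝ E]
    (Ω : TopologicalSpace.Opens (Space d)) (f : Space d → Torus d → E → ℝ) : Prop where
  continuousOn : ContinuousOn (fun q : Space d × Torus d × E => f q.1 q.2.1 q.2.2)
    ((Ω : Set (Space d)) ×ˢ (univ : Set (Torus d)) ×ˢ (univ : Set E))
  extends_T : ∃ G : Space d × Torus d × E → ℝ,
    ContinuousOn G
      (closure ((Ω : Set (Space d)) ×ˢ (univ : Set (Torus d)) ×ˢ Metric.ball (0 : E) 1)) ∧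
    ∀ x ∈ Ω, ∀ (ξ : Torus d), ∀ z ∈ Metric.ball (0 : E) 1,
      G (x, ξ, z) = (1 - ‖z‖) * f x ξ ((1 - ‖z‖)⁻¹ • z)

/-- The strong recession function
`f^∞(x,ξ,z) = lim f(x',ξ',tz)/t` as `x' → x` in `Ω`, `ξ' → ξ` and `t → ∞`. -/
def recession {d : ℕ} {E : Type*} [NormedAddCommGroup E] [InnerProductSpace ℝ E]
    (Ω : TopologicalSpace.Opens (Space d)) (f : Space d → Torus d → E → ℝ) :
    Space d → Torus d → E → ℝ :=
  fun x ξ z => limUnder (𝓝[(Ω : Set (Space d))] x ×ˢ 𝓝 ξ ×ˢ (atTop : Filter ℝ))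
    fun q : Space d × Torus d × ℝ => f q.1 q.2.1 (q.2.2 • z) / q.2.2

/-- `I_f^ε(μ) = ∫_Ω f(x, x/ε, μ^{ac}(x)) dx + ∫_Ω f^∞(x, x/ε, μ_s(x)) d|μ^s|(x)`. -/
def scaledFunctional {d : ℕ} {E : Type*} [NormedAddCommGroup E] [InnerProductSpace ℝ E]
    (Ω : TopologicalSpace.Opens (Space d)) (f : Space d → Torus d → E → ℝ) (ε : ℝ)
    {μ : VectorMeasure (Space d) E} (D : LebesgueDecomposition μ) : ℝ :=
  (∫ x in (Ω : Set (Space d)), f x (toTorus (ε⁻¹ • x)) (D.ac x)) +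
    ∫ x in (Ω : Set (Space d)), recession Ω f x (toTorus (ε⁻¹ • x)) (D.polar x) ∂D.singVar

/-! ### Two-scale* Young measures -/

/-- A two-scale* Young measure `(ν, λ, ρ, ν^∞)` on `Ω` with values in `E`. The weak-* measurable
families of probability measures are given by Markov kernels, that is, by Borel representatives;
their values outside `cl Ω` are irrelevant. -/
structure YoungMeasure {d : ℕ} (Ω : TopologicalSpace.Opens (Space d)) (E : Type*)
    [NormedAddCommGroup E] [InnerProductSpace ℝ E] [MeasurableSpace E] where
  /-- the oscillation measures `ν_{x,ξ} ∈ Prob(E)` -/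
  osc : Kernel (Space d × Torus d) E
  /-- the concentration measure `λ` on `cl Ω` -/
  conc : Measure (Space d)
  /-- the measures `ρ_x ∈ Prob(Z)` -/
  rho : Kernel (Space d) (Torus d)
  /-- the concentration angle measures `ν^∞_{x,ξ}`, probability measures on the unit sphere -/
  oscInf : Kernel (Space d × Torus d) E
  markov_osc : IsMarkovKernel osc
  finite_conc : IsFiniteMeasure conc
  markov_rho : IsMarkovKernel rho
  markov_oscInf : IsMarkovKernel oscInf
  moment_osc : ∫⁻ q, ∫⁻ z, ‖z‖ₑ ∂(osc q)
    ∂((volume.restrict (closure (Ω : Set (Space d)))).prod (volume : Measure (Torus d))) < (⊤ : ℝ≥0∞)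
  conc_support : conc (closure (Ω : Set (Space d)))ᶜ = 0
  oscInf_sphere : ∀ᵐ q ∂(conc ⊗ₘ rho), oscInf q (Metric.sphere (0 : E) 1)ᶜ = 0

namespace YoungMeasure

variable {d : ℕ} {Ω : TopologicalSpace.Opens (Space d)} {E : Type*}
  [NormedAddCommGroup E] [InnerProductSpace ℝ E] [MeasurableSpace E]

/-- The duality product
`⟪f, ν⟫ = ∫_Ω ∫_Z ⟨f(x,ξ,·), ν_{x,ξ}⟩ dξ dx + ∫_{cl Ω} ∫_Z ⟨f^∞(x,ξ,·), ν^∞_{x,ξ}⟩ dρ_x dλ`. -/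
def dual (ν : YoungMeasure Ω E) (f : Space d → Torus d → E → ℝ) : ℝ :=
  (∫ x in (Ω : Set (Space d)), ∫ ξ : Torus d, ∫ z, f x ξ z ∂(ν.osc (x, ξ))) +
    ∫ x in closure (Ω : Set (Space d)),
      ∫ ξ, ∫ z, recession Ω f x ξ z ∂(ν.oscInf (x, ξ)) ∂(ν.rho x) ∂ν.conc

/-- The sequence `μ_j ∈ ℳ(Ω; E)` generates `ν` along the scales `ε_j`: for each integrand `f`,
`I_f^{ε_j}(μ_j) → ⟪f, ν⟫`. -/
def IsGeneratedBy (ν : YoungMeasure Ω E) (ε : ℕ → ℝ)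
    (μ : ℕ → VectorMeasure (Space d) E) : Prop :=
  ∃ D : (j : ℕ) → LebesgueDecomposition (μ j),
    ∀ f : Space d → Torus d → E → ℝ, IsIntegrand Ω f →
      Tendsto (fun j => scaledFunctional Ω f (ε j) (D j)) atTop (𝓝 (ν.dual f))

/-- `ν` is `𝒜`-free: there are scales `ε_j ↘ 0` and measures `μ_j ∈ ℳ(Ω; E)` (regarded as
measures on `ℝ^d` concentrated on `Ω`) with `𝒜μ_j → 0` strongly in `W^{-k,p}(Ω)` that
generate `ν`. -/
def IsAFree {F : Type*} [FiniteDimensional ℝ E]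
    [NormedAddCommGroup F] [InnerProductSpace ℝ F] [FiniteDimensional ℝ F]
    (k : ℕ) (A : (Fin d → ℕ) → E →ₗ[ℝ] F) (p : ℝ) (ν : YoungMeasure Ω E) : Prop :=
  ∃ (ε : ℕ → ℝ) (μ : ℕ → VectorMeasure (Space d) E),
    (∀ j, 0 < ε j) ∧ Tendsto ε atTop (𝓝 0) ∧
    (∀ j, (μ j).restrict (Ω : Set (Space d)) = μ j) ∧
    Tendsto (fun j => negSobolevNorm k p Ω (opMeasure k A Ω (μ j))) atTop (𝓝 0) ∧
    ν.IsGeneratedBy ε μ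

/-- The singular part `λ^s` of `λ` with respect to the Lebesgue measure. -/
def concSing (ν : YoungMeasure Ω E) : Measure (Space d) := ν.conc.singularPart volume

/-- `cl Ω = (cl Ω \ S) ∪ S` is a partition into regular and singular points: `ℒ^d(S) = 0` and
`λ^s(cl Ω \ S) = 0`. -/
structure IsSingularSet (ν : YoungMeasure Ω E) (S : Set (Space d)) : Prop where
  measurable : MeasurableSet S
  subset : S ⊆ closure (Ω : Set (Space d))
  volume_eq : volume S = 0
  concSing_eq : ν.concSing (closure (Ω : Set (Space d)) \ S) = 0

open Classical in
/-- The second-scale barycenter `⟦ν⟧_x ∈ ℳ(Z; E)`, relative to the set `S` of singular points: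
`⟨id, ν_{x,ξ}⟩ dξ + λ^{ac}(x) ⟨id, ν^∞_{x,ξ}⟩ ρ_x` at regular points and `⟨id, ν^∞_{x,ξ}⟩ ρ_x` at
singular points. -/
def secondBarycenter (ν : YoungMeasure Ω E) (S : Set (Space d)) (x : Space d) :
    VectorMeasure (Torus d) E :=
  if x ∈ S then
    (ν.rho x).withDensityᵥ fun ξ => ∫ z, z ∂(ν.oscInf (x, ξ))
  else
    (volume : Measure (Torus d)).withDensityᵥ (fun ξ => ∫ z, z ∂(ν.osc (x, ξ))) +
      (ν.conc.rnDeriv volume x).toReal •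
        (ν.rho x).withDensityᵥ fun ξ => ∫ z, z ∂(ν.oscInf (x, ξ))

end YoungMeasure

end TwoScale

end

set_option linter.unusedSectionVars false
set_option linter.unusedVariables false

noncomputable section

namespace TwoScale

/-! ### Pairings with vector measures given by densities -/

section Pairing

variable {X E : Type*} [MeasurableSpace X] [NormedAddCommGroup E] [InnerProductSpace ℝ E]

/-! Let g be smooth and periodic, let φ be smooth with compact support in Ω, and test 𝒜μ_j with
Ψ_j(x) = ε_j^k φ(x) g(x/ε_j). A derivative that falls on the oscillating factor costs ε_j⁻¹, so the
derivatives of Ψ_j of order at most k stay bounded (`exists_sobolevNorm_oscillating_le`) and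
𝒜μ_j[Ψ_j] → 0. At order exactly k, only the term with all derivatives on g survives: 𝒜^*Ψ_j = φ
(𝒜^*g)(·/ε_j) + O(ε_j) uniformly (`exists_bound_adjointOp_oscillating_sub`). The error is negligible
against μ_j, because ‖z‖ is itself an integrand and so the masses of the μ_j on Ω converge. Hence
the functionals of f(x,ξ,z) = φ(x) 𝒜^*g(ξ)·z tend to 0, while generation makes them tend to the
duality product of ν with f, which therefore vanishes (`YoungMeasure.IsAFree.dual_eq_zero`).

Since f is linear in z, this product sees only barycenters. It equals ∫ φ h d(ℒ^d + λ^s), where h(x)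
pairs 𝒜^*g with the second-scale barycenter at x (`integral_mul_baryPairing`,
`ae_pairing_secondBarycenter`). As φ is arbitrary, h = 0 almost everywhere in Ω. The null set
depends on g; the separability of C(Z;E) and the continuity of the pairing in the uniform norm
remove this dependence (`ae_forall_pairing_eq_zero`). -/

theorem isFiniteMeasure_variation_withDensityᵥ [CompleteSpace E] {m : Measure X} {u : X → E}
    (hu : Integrable u m) : IsFiniteMeasure (m.withDensityᵥ u).variation := by
  rw [Measure.variation_withDensityᵥ hu]
  exact isFiniteMeasure_withDensity hu.2.ne

theorem integrable_inner_of_bound {m : Measure X} {u ψ : X → E}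
    (hu : Integrable u m) (hψ : AEStronglyMeasurable ψ m) {C : ℝ} (hC : ∀ x, ‖ψ x‖ ≤ C) :
    Integrable (fun x => inner ℝ (ψ x) (u x)) m := by
  refine (hu.norm.const_mul C).mono' (hψ.inner hu.1) (.of_forall fun x => ?_)
  exact (norm_inner_le_norm _ _).trans (by gcongr; exact hC x)

theorem integrable_simpleFunc_inner {m : Measure X} {u : X → E}
    (hu : Integrable u m) (φ : SimpleFunc X E) :
    Integrable (fun x => inner ℝ (φ x) (u x)) m := by
  obtain ⟨C, hC⟩ := φ.exists_forall_norm_le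
  exact integrable_inner_of_bound hu φ.aestronglyMeasurable hC

/-- The pairing with a simple function. -/
theorem pairing_withDensityᵥ_simpleFunc [CompleteSpace E] {m : Measure X} {u : X → E}
    (hu : Integrable u m) (φ : SimpleFunc X E) :
    pairing φ (m.withDensityᵥ u) = ∫ x, inner ℝ (φ x) (u x) ∂m := by
  have := isFiniteMeasure_variation_withDensityᵥ hu
  induction φ using SimpleFunc.induction with
  | @const c s hs =>
    have h1 : pairing (s.indicator fun _ => c) (m.withDensityᵥ u)
        = inner ℝ c (m.withDensityᵥ u s) := by
      rw [pairing, VectorMeasure.integral, setToFun_indicator_const _ hs (measure_ne_top _ _)]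
      rfl
    have h2 : ∀ x, inner ℝ (s.indicator (fun _ => c) x) (u x)
        = s.indicator (fun x => inner ℝ c (u x)) x := by
      intro x
      by_cases hx : x ∈ s <;> simp [hx]
    have h3 : ⇑(SimpleFunc.piecewise s hs (SimpleFunc.const X c) (SimpleFunc.const X 0))
        = s.indicator fun _ => c := by
      ext x
      simp [Set.indicator, Set.piecewise]
    rw [h3, h1, withDensityᵥ_apply hu hs]
    simp_rw [h2]
    rw [integral_indicator hs, integral_inner hu.integrableOn]
  | @add f g hd hf hg =>
    have hint : ∀ φ : SimpleFunc X E, (m.withDensityᵥ u).Integrable φ := fun φ =>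
      φ.integrable_of_isFiniteMeasure
    have : pairing (⇑(f + g)) (m.withDensityᵥ u)
        = pairing f (m.withDensityᵥ u) + pairing g (m.withDensityᵥ u) := by
      rw [pairing, SimpleFunc.coe_add, VectorMeasure.integral_add (hint f) (hint g)]
      rfl
    rw [this, hf, hg, ← integral_add (integrable_simpleFunc_inner hu f)
      (integrable_simpleFunc_inner hu g)]
    simp [inner_add_left]

/-- Bounded simple approximations of ψ pass to the limit on both sides by dominated convergence; on
the left this uses that the variation is finite. -/
theorem pairing_withDensityᵥ [CompleteSpace E] {m : Measure X} {u : X → E}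
    (hu : Integrable u m) {ψ : X → E} (hψ : StronglyMeasurable ψ) {C : ℝ} (hC : ∀ x, ‖ψ x‖ ≤ C) :
    pairing ψ (m.withDensityᵥ u) = ∫ x, inner ℝ (ψ x) (u x) ∂m := by
  have := isFiniteMeasure_variation_withDensityᵥ hu
  rcases isEmpty_or_nonempty X with hX | ⟨⟨x₀⟩⟩
  · simp [pairing, VectorMeasure.integral_of_isEmpty, integral_of_isEmpty]
  have hC0 : 0 ≤ C := (norm_nonneg _).trans (hC x₀)
  have hb := hψ.norm_approxBounded_le hC0
  have hl : ∀ x, Tendsto (fun n => hψ.approxBounded C n x) atTop (𝓝 (ψ x)) := fun x =>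
    hψ.tendsto_approxBounded_of_norm_le (hC x)
  have h1 : Tendsto (fun n => pairing (hψ.approxBounded C n) (m.withDensityᵥ u)) atTop
      (𝓝 (pairing ψ (m.withDensityᵥ u))) :=
    VectorMeasure.tendsto_integral_of_dominated_convergence (fun _ => C)
      (fun n => (hψ.approxBounded C n).aestronglyMeasurable) (integrable_const C)
      (fun n => .of_forall (hb n)) (.of_forall hl)
  have h2 : Tendsto (fun n => ∫ x, inner ℝ (hψ.approxBounded C n x) (u x) ∂m) atTop
      (𝓝 (∫ x, inner ℝ (ψ x) (u x) ∂m)) := by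
    refine tendsto_integral_of_dominated_convergence (fun x => C * ‖u x‖)
      (fun n => (integrable_simpleFunc_inner hu _).1) (hu.norm.const_mul C)
      (fun n => .of_forall fun x => ?_) (.of_forall fun x => (hl x).inner tendsto_const_nhds)
    exact (norm_inner_le_norm _ _).trans (by gcongr; exact hb n x)
  simp_rw [pairing_withDensityᵥ_simpleFunc hu] at h1
  exact tendsto_nhds_unique h1 h2

/-- Both a Lebesgue decomposition and the barycenter at a regular point have this form: two
densities against different base measures. -/
theorem pairing_add_withDensityᵥ [CompleteSpace E] {m m' : Measure X} {u u' : X → E}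
    (hu : Integrable u m) (hu' : Integrable u' m') {ψ : X → E} (hψ : StronglyMeasurable ψ)
    {C : ℝ} (hC : ∀ x, ‖ψ x‖ ≤ C) :
    pairing ψ (m.withDensityᵥ u + m'.withDensityᵥ u')
      = ∫ x, inner ℝ (ψ x) (u x) ∂m + ∫ x, inner ℝ (ψ x) (u' x) ∂m' := by
  have := isFiniteMeasure_variation_withDensityᵥ hu
  have := isFiniteMeasure_variation_withDensityᵥ hu'
  have hint : ∀ η : VectorMeasure X E, IsFiniteMeasure η.variation → η.Integrable ψ := fun η _ =>
    (integrable_const C).mono' hψ.aestronglyMeasurable (.of_forall hC)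
  rw [← pairing_withDensityᵥ hu hψ hC, ← pairing_withDensityᵥ hu' hψ hC]
  exact VectorMeasure.integral_add_vectorMeasure (hint _ ‹_›) (hint _ ‹_›)

theorem pairing_smul_left (c : ℝ) (ψ : X → E) (η : VectorMeasure X E) :
    pairing (c • ψ) η = c * pairing ψ η :=
  VectorMeasure.integral_smul ψ η (innerSL ℝ) c

end Pairing

/-! ### Iterated partial derivatives -/

section IteratedPartials

variable {d : ℕ} {F : Type*} [NormedAddCommGroup F] [NormedSpace ℝ F]

theorem contDiff_partialDeriv (i : Fin d) {φ : Space d → F} (hφ : ContDiff ℝ ∞ φ) :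
    ContDiff ℝ ∞ (partialDeriv i φ) :=
  (hφ.fderiv_right (m := ∞) (by simp)).clm_apply contDiff_const

theorem partialDeriv_add (i : Fin d) {φ ψ : Space d → F} (hφ : ContDiff ℝ ∞ φ)
    (hψ : ContDiff ℝ ∞ ψ) : partialDeriv i (φ + ψ) = partialDeriv i φ + partialDeriv i ψ := by
  ext x
  simp [partialDeriv, fderiv_add (hφ.differentiable (by simp) x) (hψ.differentiable (by simp) x)]

theorem partialDeriv_smul (i : Fin d) (c : ℝ) {φ : Space d → F} (hφ : ContDiff ℝ ∞ φ) :
    partialDeriv i (c • φ) = c • partialDeriv i φ := by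
  ext x
  simp [partialDeriv, fderiv_const_smul (hφ.differentiable (by simp) x)]

theorem IsPeriodic.partialDeriv (i : Fin d) {g : Space d → F} (hg : IsPeriodic g) :
    IsPeriodic (partialDeriv i g) := by
  intro m x
  have : (fun y => g (y + WithLp.toLp 2 fun i => (m i : ℝ))) = g := funext (hg m)
  conv_rhs => rw [← this]
  simp [TwoScale.partialDeriv, fderiv_comp_add_right]

theorem support_partialDeriv_subset (i : Fin d) (φ : Space d → F) :
    Function.support (partialDeriv i φ) ⊆ tsupport φ := by
  intro x hx
  by_contra h
  have := image_eq_zero_of_notMem_tsupport (fun h' => h (tsupport_fderiv_subset ℝ h'))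
  simp [partialDeriv, this] at hx

theorem tsupport_partialDeriv_subset (i : Fin d) (φ : Space d → F) :
    tsupport (partialDeriv i φ) ⊆ tsupport φ :=
  closure_minimal (support_partialDeriv_subset i φ) (isClosed_tsupport φ)

/-- The composition of the partial derivatives along a list of coordinates, the head of the list
being applied first. -/
def iterPartial (l : List (Fin d)) (φ : Space d → F) : Space d → F :=
  l.foldl (fun ψ i => partialDeriv i ψ) φ

@[simp] theorem iterPartial_nil (φ : Space d → F) : iterPartial [] φ = φ := rfl

@[simp] theorem iterPartial_cons (i : Fin d) (l : List (Fin d)) (φ : Space d → F) :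
    iterPartial (i :: l) φ = iterPartial l (partialDeriv i φ) := rfl

theorem iterPartial_append (l l' : List (Fin d)) (φ : Space d → F) :
    iterPartial (l ++ l') φ = iterPartial l' (iterPartial l φ) := by
  simp [iterPartial]

theorem iterPartial_replicate (n : ℕ) (i : Fin d) (φ : Space d → F) :
    iterPartial (List.replicate n i) φ = (partialDeriv i)^[n] φ := by
  induction n generalizing φ with
  | zero => rfl
  | succ n ih => simp [List.replicate_succ, ih]

theorem contDiff_iterPartial (l : List (Fin d)) {φ : Space d → F} (hφ : ContDiff ℝ ∞ φ) :
    ContDiff ℝ ∞ (iterPartial l φ) := by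
  induction l generalizing φ with
  | nil => exact hφ
  | cons i l ih => exact ih (contDiff_partialDeriv i hφ)

theorem iterPartial_add (l : List (Fin d)) {φ ψ : Space d → F} (hφ : ContDiff ℝ ∞ φ)
    (hψ : ContDiff ℝ ∞ ψ) : iterPartial l (φ + ψ) = iterPartial l φ + iterPartial l ψ := by
  induction l generalizing φ ψ with
  | nil => rfl
  | cons i l ih =>
    rw [iterPartial_cons, partialDeriv_add i hφ hψ,
      ih (contDiff_partialDeriv i hφ) (contDiff_partialDeriv i hψ)]
    rfl

theorem iterPartial_smul (l : List (Fin d)) (c : ℝ) {φ : Space d → F} (hφ : ContDiff ℝ ∞ φ) :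
    iterPartial l (c • φ) = c • iterPartial l φ := by
  induction l generalizing φ with
  | nil => rfl
  | cons i l ih =>
    rw [iterPartial_cons, partialDeriv_smul i c hφ, ih (contDiff_partialDeriv i hφ)]
    rfl

theorem IsPeriodic.iterPartial (l : List (Fin d)) {g : Space d → F} (hg : IsPeriodic g) :
    IsPeriodic (iterPartial l g) := by
  induction l generalizing g with
  | nil => exact hg
  | cons i l ih => exact ih (hg.partialDeriv i)

theorem tsupport_iterPartial_subset (l : List (Fin d)) (φ : Space d → F) :
    tsupport (iterPartial l φ) ⊆ tsupport φ := by
  induction l generalizing φ with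
  | nil => exact subset_rfl
  | cons i l ih => exact (ih _).trans (tsupport_partialDeriv_subset i φ)

variable (F) in
-- Lists of coordinates allow induction on one derivative at a time, with the length recording the
-- order.
theorem exists_multiDeriv_eq_iterPartial (α : Fin d → ℕ) :
    ∃ l : List (Fin d), l.length = ∑ i, α i ∧
      ∀ φ : Space d → F, multiDeriv α φ = iterPartial l φ := by
  have key : ∀ L : List (Fin d), ∃ l : List (Fin d), l.length = (L.map α).sum ∧
      ∀ φ : Space d → F, L.foldr (fun i ψ => (partialDeriv i)^[α i] ψ) φ = iterPartial l φ := by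
    intro L
    induction L with
    | nil => exact ⟨[], rfl, fun _ => rfl⟩
    | cons i L ih =>
      obtain ⟨l, hl, h⟩ := ih
      -- `foldr` applies the head of `L` last, while `iterPartial` applies the head of its list
      -- first, so the new block goes to the end.
      refine ⟨l ++ List.replicate (α i) i, by simp [hl, add_comm], fun φ => ?_⟩
      rw [List.foldr_cons, h, iterPartial_append, iterPartial_replicate]
  obtain ⟨l, hl, h⟩ := key (List.finRange d)
  exact ⟨l, by rw [hl, ← List.sum_ofFn, List.ofFn_eq_map], h⟩

theorem contDiff_multiDeriv (α : Fin d → ℕ) {φ : Space d → F} (hφ : ContDiff ℝ ∞ φ) :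
    ContDiff ℝ ∞ (multiDeriv α φ) := by
  obtain ⟨l, -, h⟩ := exists_multiDeriv_eq_iterPartial F α
  rw [h]
  exact contDiff_iterPartial l hφ

theorem multiDeriv_smul (α : Fin d → ℕ) (c : ℝ) {φ : Space d → F} (hφ : ContDiff ℝ ∞ φ) :
    multiDeriv α (c • φ) = c • multiDeriv α φ := by
  obtain ⟨l, -, h⟩ := exists_multiDeriv_eq_iterPartial F α
  rw [h, h, iterPartial_smul l c hφ]

theorem IsPeriodic.multiDeriv (α : Fin d → ℕ) {g : Space d → F} (hg : IsPeriodic g) :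
    IsPeriodic (multiDeriv α g) := by
  obtain ⟨l, -, h⟩ := exists_multiDeriv_eq_iterPartial F α
  rw [h]
  exact hg.iterPartial l

theorem tsupport_multiDeriv_subset (α : Fin d → ℕ) (φ : Space d → F) :
    tsupport (multiDeriv α φ) ⊆ tsupport φ := by
  obtain ⟨l, -, h⟩ := exists_multiDeriv_eq_iterPartial F α
  rw [h]
  exact tsupport_iterPartial_subset l φ

theorem sum_eq_of_mem_multiIndices {k : ℕ} {α : Fin d → ℕ} (hα : α ∈ multiIndices d k) :
    ∑ i, α i = k := by
  simpa [multiIndices, Finset.mem_piAntidiag] using hα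

end IteratedPartials

/-! ### Periodic functions as functions on the torus -/

section Torus

variable {d : ℕ} {F : Type*}

theorem isOpenQuotientMap_toTorus : IsOpenQuotientMap (toTorus (d := d)) :=
  (IsOpenQuotientMap.piMap fun _ => QuotientAddGroup.isOpenQuotientMap_mk).comp
    (EuclideanSpace.equiv (Fin d) ℝ).toHomeomorph.isOpenQuotientMap

theorem toTorus_torusRep (ξ : Torus d) : toTorus (torusRep ξ) = ξ := by
  ext i
  exact (AddCircle.equivIco (1 : ℝ) 0).symm_apply_apply (ξ i)

theorem IsPeriodic.apply_torusRep_toTorus {g : Space d → F} (hg : IsPeriodic g) (x : Space d) :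
    g (torusRep (toTorus x)) = g x := by
  have h : ∀ i, ∃ m : ℤ, torusRep (toTorus x) i = x i + m := by
    intro i
    have : ((torusRep (toTorus x) i : ℝ) : UnitAddCircle) = (x i : UnitAddCircle) :=
      congrFun (toTorus_torusRep (toTorus x)) i
    obtain ⟨m, hm⟩ := AddSubgroup.mem_zmultiples_iff.1 (QuotientAddGroup.eq_iff_sub_mem.1 this)
    exact ⟨m, by simp only [zsmul_eq_mul, mul_one] at hm; linarith⟩
  choose m hm using h
  rw [← hg m x]
  congr 1
  ext i
  simp [hm]

/-- Although `torusRep` jumps, the composition is the function that g induces on the quotient, so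
its continuity can be checked after composing with `toTorus`. -/
theorem IsPeriodic.continuous_comp_torusRep [TopologicalSpace F] {g : Space d → F}
    (hg : IsPeriodic g) (hc : Continuous g) : Continuous fun ξ : Torus d => g (torusRep ξ) := by
  refine isOpenQuotientMap_toTorus.isQuotientMap.continuous_iff.2 ?_
  convert hc using 1
  exact funext hg.apply_torusRep_toTorus

theorem IsPeriodic.exists_bound [NormedAddCommGroup F] {g : Space d → F}
    (hg : IsPeriodic g) (hc : Continuous g) : ∃ C, ∀ x, ‖g x‖ ≤ C := by
  obtain ⟨C, hC⟩ := isCompact_univ.exists_bound_of_continuousOn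
    (hg.continuous_comp_torusRep hc).continuousOn
  exact ⟨C, fun x => hg.apply_torusRep_toTorus x ▸ hC (toTorus x) (mem_univ _)⟩

end Torus

/-! ### Derivatives of oscillating test functions -/

section Oscillating

variable {d : ℕ} {F : Type*} [NormedAddCommGroup F] [NormedSpace ℝ F]

/-- The oscillating function `x ↦ φ(x) g(x/ε)`. -/
def oscillating (φ : Space d → ℝ) (g : Space d → F) (ε : ℝ) : Space d → F :=
  fun x => φ x • g (ε⁻¹ • x)

theorem contDiff_oscillating {φ : Space d → ℝ} {g : Space d → F} (hφ : ContDiff ℝ ∞ φ)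
    (hg : ContDiff ℝ ∞ g) (ε : ℝ) : ContDiff ℝ ∞ (oscillating φ g ε) :=
  hφ.smul (hg.comp (contDiff_const_smul _))

theorem partialDeriv_oscillating (i : Fin d) {φ : Space d → ℝ} {g : Space d → F}
    (hφ : ContDiff ℝ ∞ φ) (hg : ContDiff ℝ ∞ g) (ε : ℝ) :
    partialDeriv i (oscillating φ g ε)
      = oscillating (partialDeriv i φ) g ε + ε⁻¹ • oscillating φ (partialDeriv i g) ε := by
  ext x
  have h1 : HasFDerivAt φ (fderiv ℝ φ x) x := (hφ.differentiable (by simp) x).hasFDerivAt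
  have h2 : HasFDerivAt g (fderiv ℝ g (ε⁻¹ • x)) (ε⁻¹ • x) :=
    (hg.differentiable (by simp) _).hasFDerivAt
  have h3 : HasFDerivAt (fun y : Space d => ε⁻¹ • y) (ε⁻¹ • ContinuousLinearMap.id ℝ (Space d)) x :=
    (hasFDerivAt_id x).const_smul ε⁻¹
  have h4 := h1.smul (h2.comp x h3)
  have : fderiv ℝ (oscillating φ g ε) x = _ := h4.fderiv
  simp only [partialDeriv, this, Pi.add_apply, Pi.smul_apply, oscillating,
    add_apply, smul_apply, ContinuousLinearMap.smulRight_apply,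
    ContinuousLinearMap.comp_apply, ContinuousLinearMap.id_apply, map_smul, Function.comp_apply]
  rw [add_comm, smul_comm]

theorem exists_bound_oscillating {φ : Space d → ℝ} {g : Space d → F} (hφ : Continuous φ)
    (hφ' : HasCompactSupport φ) (hg : Continuous g) (hg' : IsPeriodic g) :
    ∃ C, 0 ≤ C ∧ ∀ ε x, ‖oscillating φ g ε x‖ ≤ C := by
  obtain ⟨C, hC⟩ := hφ.bounded_above_of_compact_support hφ'
  obtain ⟨C', hC'⟩ := hg'.exists_bound hg
  have h0 : 0 ≤ C := (norm_nonneg _).trans (hC 0)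
  have h0' : 0 ≤ C' := (norm_nonneg _).trans (hC' 0)
  refine ⟨C * C', by positivity, fun ε x => ?_⟩
  rw [oscillating, norm_smul]
  gcongr
  exacts [hC x, hC' _]

/-- The recursion behind both estimates below: a derivative on φ leaves a spare factor ε, and one on
g uses it up. -/
theorem smul_iterPartial_cons_oscillating (i : Fin d) (l : List (Fin d)) {φ : Space d → ℝ}
    {g : Space d → F} (hφ : ContDiff ℝ ∞ φ) (hg : ContDiff ℝ ∞ g) {ε : ℝ} (hε : 0 < ε)
    (x : Space d) :
    ε ^ (i :: l).length • iterPartial (i :: l) (oscillating φ g ε) x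
      = ε • ε ^ l.length • iterPartial l (oscillating (partialDeriv i φ) g ε) x
        + ε ^ l.length • iterPartial l (oscillating φ (partialDeriv i g) ε) x := by
  have h1 := contDiff_oscillating (contDiff_partialDeriv i hφ) hg ε
  have h2 := contDiff_oscillating hφ (contDiff_partialDeriv i hg) ε
  have h3 : ContDiff ℝ ∞ (ε⁻¹ • oscillating φ (partialDeriv i g) ε) := contDiff_const.smul h2
  rw [iterPartial_cons, partialDeriv_oscillating i hφ hg, iterPartial_add l h1 h3,
    iterPartial_smul l _ h2]
  simp only [Pi.add_apply, Pi.smul_apply, smul_add, smul_smul, List.length_cons]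
  congr 2
  · rw [pow_succ']
  · rw [pow_succ']
    field_simp

theorem exists_bound_iterPartial_oscillating (l : List (Fin d)) {φ : Space d → ℝ}
    {g : Space d → F} (hφ : ContDiff ℝ ∞ φ) (hφ' : HasCompactSupport φ) (hg : ContDiff ℝ ∞ g)
    (hg' : IsPeriodic g) :
    ∃ C, 0 ≤ C ∧ ∀ ε, 0 < ε → ε ≤ 1 → ∀ x,
      ‖ε ^ l.length • iterPartial l (oscillating φ g ε) x‖ ≤ C := by
  induction l generalizing φ g with
  | nil =>
    obtain ⟨C, h0, hC⟩ := exists_bound_oscillating hφ.continuous hφ' hg.continuous hg'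
    exact ⟨C, h0, fun ε _ _ x => by simpa using hC ε x⟩
  | cons i l ih =>
    obtain ⟨C, h0, hC⟩ := ih (contDiff_partialDeriv i hφ)
      (hφ'.mono' (support_partialDeriv_subset i φ)) hg hg'
    obtain ⟨C', h0', hC'⟩ := ih hφ hφ' (contDiff_partialDeriv i hg) (hg'.partialDeriv i)
    refine ⟨C + C', by positivity, fun ε hε hε1 x => ?_⟩
    rw [smul_iterPartial_cons_oscillating i l hφ hg hε]
    refine (norm_add_le _ _).trans (add_le_add ?_ (hC' ε hε hε1 x))
    rw [norm_smul, Real.norm_of_nonneg hε.le]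
    exact (mul_le_of_le_one_left (norm_nonneg _) hε1).trans (hC ε hε hε1 x)

/-- By induction on `l`: the branch where the derivative hits φ is ε times a bounded quantity, and
the other is the induction hypothesis for `partialDeriv i g`. -/
theorem exists_bound_iterPartial_oscillating_sub (l : List (Fin d)) {φ : Space d → ℝ}
    {g : Space d → F} (hφ : ContDiff ℝ ∞ φ) (hφ' : HasCompactSupport φ) (hg : ContDiff ℝ ∞ g)
    (hg' : IsPeriodic g) :
    ∃ C, 0 ≤ C ∧ ∀ ε, 0 < ε → ε ≤ 1 → ∀ x,
      ‖ε ^ l.length • iterPartial l (oscillating φ g ε) x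
        - oscillating φ (iterPartial l g) ε x‖ ≤ C * ε := by
  induction l generalizing φ g with
  | nil => exact ⟨0, le_rfl, fun ε _ _ x => by simp⟩
  | cons i l ih =>
    obtain ⟨C, h0, hC⟩ := exists_bound_iterPartial_oscillating l (contDiff_partialDeriv i hφ)
      (hφ'.mono' (support_partialDeriv_subset i φ)) hg hg'
    obtain ⟨C', h0', hC'⟩ := ih hφ hφ' (contDiff_partialDeriv i hg) (hg'.partialDeriv i)
    refine ⟨C + C', by positivity, fun ε hε hε1 x => ?_⟩
    rw [smul_iterPartial_cons_oscillating i l hφ hg hε, add_sub_assoc, add_mul]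
    refine (norm_add_le _ _).trans (add_le_add ?_ (hC' ε hε hε1 x))
    rw [norm_smul, Real.norm_of_nonneg hε.le, mul_comm]
    gcongr
    exact hC ε hε hε1 x

/-- Sup bounds on the derivatives give L^q bounds for every q, since Ω has finite measure. -/
theorem exists_sobolevNorm_oscillating_le {Ω : TopologicalSpace.Opens (Space d)}
    (hΩ : Bornology.IsBounded (Ω : Set (Space d))) (k : ℕ) (q : ℝ≥0∞) {φ : Space d → ℝ}
    {g : Space d → F} (hφ : ContDiff ℝ ∞ φ) (hφ' : HasCompactSupport φ) (hg : ContDiff ℝ ∞ g)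
    (hg' : IsPeriodic g) :
    ∃ M : ℝ, 0 < M ∧ ∀ ε, 0 < ε → ε ≤ 1 → ∀ Ψ : 𝓓(Ω, F), ⇑Ψ = ε ^ k • oscillating φ g ε →
      sobolevNorm k q Ω Ψ ≤ ENNReal.ofReal M := by
  have : IsFiniteMeasure (volume.restrict (Ω : Set (Space d))) :=
    isFiniteMeasure_restrict.2 hΩ.measure_lt_top.ne
  have key : ∀ j ∈ Finset.range (k + 1), ∀ α ∈ multiIndices d j, ∃ M : ℝ≥0∞, M < ⊤ ∧
      ∀ ε, 0 < ε → ε ≤ 1 → ∀ Ψ : 𝓓(Ω, F), ⇑Ψ = ε ^ k • oscillating φ g ε →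
        eLpNorm (multiDeriv α Ψ) q (volume.restrict (Ω : Set (Space d))) ≤ M := by
    intro j hj α hα
    obtain ⟨l, hl, h⟩ := exists_multiDeriv_eq_iterPartial F α
    rw [sum_eq_of_mem_multiIndices hα] at hl
    obtain ⟨C, h0, hC⟩ := exists_bound_iterPartial_oscillating l hφ hφ' hg hg'
    refine ⟨_, ?_, fun ε hε hε1 Ψ hΨ => eLpNorm_le_of_ae_bound (C := C) (.of_forall fun x => ?_)⟩
    · exact ENNReal.mul_lt_top (ENNReal.rpow_lt_top_of_nonneg (by positivity)
        (measure_ne_top _ _)) ENNReal.ofReal_lt_top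
    -- Of the factor ε^k, the part ε^j absorbs the j derivatives and the remaining ε^m is at most 1.
    · obtain ⟨m, rfl⟩ : ∃ m, k = m + j := ⟨k - j, by grind⟩
      rw [h, hΨ, iterPartial_smul l _ (contDiff_oscillating hφ hg ε), Pi.smul_apply, pow_add,
        mul_smul, norm_smul, ← hl]
      refine (mul_le_of_le_one_left (norm_nonneg _) ?_).trans (hC ε hε hε1 x)
      rw [Real.norm_of_nonneg (by positivity)]
      exact pow_le_one₀ hε.le hε1
  choose! M hM hMb using key
  have hlt : ∑ j ∈ Finset.range (k + 1), ∑ α ∈ multiIndices d j, M j α < ⊤ :=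
    ENNReal.sum_lt_top.2 fun j hj => ENNReal.sum_lt_top.2 fun α hα => hM j hj α hα
  -- The added 1 makes the bound positive, so that test functions can later be divided by it.
  refine ⟨(∑ j ∈ Finset.range (k + 1), ∑ α ∈ multiIndices d j, M j α).toReal + 1, by positivity,
    fun ε hε hε1 Ψ hΨ => ?_⟩
  refine le_trans (Finset.sum_le_sum fun j hj => Finset.sum_le_sum fun α hα =>
    hMb j hj α hα ε hε hε1 Ψ hΨ) ?_
  rw [ENNReal.ofReal_add (by positivity) (by positivity), ENNReal.ofReal_toReal hlt.ne]
  exact le_self_add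

end Oscillating

/-! ### The formal adjoint on oscillating test functions -/

section AdjointOp

variable {d : ℕ} {E F : Type*}
    [NormedAddCommGroup E] [InnerProductSpace ℝ E] [FiniteDimensional ℝ E]
    [NormedAddCommGroup F] [InnerProductSpace ℝ F] [FiniteDimensional ℝ F]
    (k : ℕ) (A : (Fin d → ℕ) → E →ₗ[ℝ] F)

theorem continuous_adjointOp {φ : Space d → F} (hφ : ContDiff ℝ ∞ φ) :
    Continuous (adjointOp k A φ) := by
  refine Continuous.const_smul (continuous_finsetSum _ fun α _ => ?_) _
  exact (LinearMap.continuous_of_finiteDimensional _).comp (contDiff_multiDeriv α hφ).continuous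

theorem IsPeriodic.adjointOp {g : Space d → F} (hg : IsPeriodic g) :
    IsPeriodic (adjointOp k A g) := by
  intro m x
  simp only [TwoScale.adjointOp, hg.multiDeriv _ m x]

theorem adjointOp_smul (c : ℝ) {φ : Space d → F} (hφ : ContDiff ℝ ∞ φ) :
    adjointOp k A (c • φ) = c • adjointOp k A φ := by
  ext x
  simp only [adjointOp, multiDeriv_smul _ c hφ, Pi.smul_apply, map_smul, ← Finset.smul_sum]
  rw [smul_comm]

theorem adjointOp_eq_zero_of_notMem_tsupport {φ : Space d → F} {x : Space d}
    (hx : x ∉ tsupport φ) : adjointOp k A φ x = 0 := by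
  have : ∀ α, multiDeriv α φ x = 0 := fun α =>
    image_eq_zero_of_notMem_tsupport fun h => hx (tsupport_multiDeriv_subset α φ h)
  simp [adjointOp, this]

/-- All derivatives in the homogeneous operator have order k, so the one factor ε^k balances each of
them and the termwise errors O(ε) add up. -/
theorem exists_bound_adjointOp_oscillating_sub {φ : Space d → ℝ} {g : Space d → F}
    (hφ : ContDiff ℝ ∞ φ) (hφ' : HasCompactSupport φ) (hg : ContDiff ℝ ∞ g)
    (hg' : IsPeriodic g) :
    ∃ C, 0 ≤ C ∧ ∀ ε, 0 < ε → ε ≤ 1 → ∀ x,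
      ‖adjointOp k A (ε ^ k • oscillating φ g ε) x - φ x • adjointOp k A g (ε⁻¹ • x)‖
        ≤ C * ε := by
  have key : ∀ α ∈ multiIndices d k, ∃ C, 0 ≤ C ∧ ∀ ε, 0 < ε → ε ≤ 1 → ∀ x,
      ‖LinearMap.adjoint (A α) (ε ^ k • multiDeriv α (oscillating φ g ε) x)
        - LinearMap.adjoint (A α) (φ x • multiDeriv α g (ε⁻¹ • x))‖ ≤ C * ε := by
    intro α hα
    obtain ⟨l, hl, h⟩ := exists_multiDeriv_eq_iterPartial F α
    rw [sum_eq_of_mem_multiIndices hα] at hl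
    obtain ⟨C, h0, hC⟩ := exists_bound_iterPartial_oscillating_sub l hφ hφ' hg hg'
    refine ⟨‖LinearMap.toContinuousLinearMap (LinearMap.adjoint (A α))‖ * C, by positivity,
      fun ε hε hε1 x => ?_⟩
    rw [← map_sub, mul_assoc, h, h, ← hl]
    refine ((LinearMap.toContinuousLinearMap (LinearMap.adjoint (A α))).le_opNorm _).trans ?_
    gcongr
    exact hC ε hε hε1 x
  choose! C h0 hC using key
  refine ⟨∑ α ∈ multiIndices d k, C α, Finset.sum_nonneg h0, fun ε hε hε1 x => ?_⟩
  rw [adjointOp_smul k A _ (contDiff_oscillating hφ hg ε)]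
  have : (ε ^ k • adjointOp k A (oscillating φ g ε)) x - φ x • adjointOp k A g (ε⁻¹ • x)
      = (-1 : ℝ) ^ k • ∑ α ∈ multiIndices d k,
        (LinearMap.adjoint (A α) (ε ^ k • multiDeriv α (oscillating φ g ε) x)
          - LinearMap.adjoint (A α) (φ x • multiDeriv α g (ε⁻¹ • x))) := by
    simp only [adjointOp, Pi.smul_apply, map_smul, Finset.sum_sub_distrib, ← Finset.smul_sum,
      smul_sub]
    rw [smul_comm, smul_comm (φ x)]
  rw [this, norm_smul, norm_pow, norm_neg, norm_one, one_pow, one_mul, Finset.sum_mul]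
  exact (norm_sum_le _ _).trans (Finset.sum_le_sum fun α hα => hC α hα ε hε hε1 x)

end AdjointOp

/-! ### Positively one-homogeneous integrands -/

section Homogeneous

variable {d : ℕ} {E : Type*} [NormedAddCommGroup E] [InnerProductSpace ℝ E]
  {Ω : TopologicalSpace.Opens (Space d)} {f : Space d → Torus d → E → ℝ}

/-- By homogeneity the factors 1 - ‖z‖ cancel, so the transform of f is f itself and f is its own
extension. -/
theorem isIntegrand_of_homogeneous
    (hf : Continuous fun q : Space d × Torus d × E => f q.1 q.2.1 q.2.2)
    (hom : ∀ x ξ z (t : ℝ), 0 < t → f x ξ (t • z) = t * f x ξ z) : IsIntegrand Ω f where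
  continuousOn := hf.continuousOn
  extends_T := by
    refine ⟨fun q => f q.1 q.2.1 q.2.2, hf.continuousOn, fun x _ ξ z hz => ?_⟩
    have h : 0 < 1 - ‖z‖ := by simpa using hz
    simp only [hom x ξ z _ (inv_pos.2 h)]
    field_simp

/-- The quotient f(x',ξ',tz)/t does not depend on t > 0, so the limit is plain continuity.
Membership in the closure makes the filter nontrivial, which is what determines `limUnder`. -/
theorem recession_eq_of_homogeneous
    (hf : Continuous fun q : Space d × Torus d × E => f q.1 q.2.1 q.2.2)
    (hom : ∀ x ξ z (t : ℝ), 0 < t → f x ξ (t • z) = t * f x ξ z) {x : Space d}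
    (hx : x ∈ closure (Ω : Set (Space d))) (ξ : Torus d) (z : E) :
    recession Ω f x ξ z = f x ξ z := by
  have := mem_closure_iff_nhdsWithin_neBot.1 hx
  refine Tendsto.limUnder_eq ?_
  have h1 : Tendsto (fun q : Space d × Torus d × ℝ => f q.1 q.2.1 z)
      (𝓝[(Ω : Set (Space d))] x ×ˢ 𝓝 ξ ×ˢ (atTop : Filter ℝ)) (𝓝 (f x ξ z)) := by
    have h2 : Tendsto (fun q : Space d × Torus d × ℝ => (q.1, q.2.1, z))
        (𝓝[(Ω : Set (Space d))] x ×ˢ 𝓝 ξ ×ˢ (atTop : Filter ℝ)) (𝓝 (x, ξ, z)) :=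
      (tendsto_fst.mono_right nhdsWithin_le_nhds).prodMk_nhds
        ((tendsto_fst.comp tendsto_snd).prodMk_nhds tendsto_const_nhds)
    exact (hf.tendsto (x, ξ, z)).comp h2
  refine h1.congr' ?_
  have h3 : ∀ᶠ q in (𝓝[(Ω : Set (Space d))] x ×ˢ 𝓝 ξ ×ˢ (atTop : Filter ℝ)), 0 < q.2.2 :=
    (tendsto_snd.comp tendsto_snd).eventually (eventually_gt_atTop 0)
  filter_upwards [h3] with q hq
  rw [hom _ _ _ _ hq, mul_div_cancel_left₀ _ hq.ne']

end Homogeneous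

namespace LebesgueDecomposition

variable {d : ℕ} {E : Type*} [NormedAddCommGroup E] [InnerProductSpace ℝ E]
  {μ : VectorMeasure (Space d) E}

theorem integrable_polar (D : LebesgueDecomposition μ) : Integrable D.polar D.singVar := by
  have := D.finite_singVar
  exact (integrable_const (1 : ℝ)).mono' D.measurable_polar (D.norm_polar.mono fun _ h => h.le)

end LebesgueDecomposition

/-! ### The integrands φ(x) a(ξ)·z and ‖z‖ -/

section LinearIntegrand

variable {d : ℕ} {E : Type*} [NormedAddCommGroup E] [InnerProductSpace ℝ E]
  (Ω : TopologicalSpace.Opens (Space d))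

/-- Since ψ vanishes off Ω, its integral already lives on Ω; ψ' need not vanish there. The estimate
serves both the absolutely continuous and the singular part of a measure. -/
theorem abs_integral_inner_sub_setIntegral_inner_le [MeasurableSpace E] [BorelSpace E]
    [SecondCountableTopology E] {m : Measure (Space d)}
    {u ψ ψ' : Space d → E} (hu : Integrable u m) (hψ : Continuous ψ) (hψ' : Continuous ψ')
    (hψ0 : ∀ x ∉ Ω, ψ x = 0) {B B' C : ℝ} (hB : ∀ x, ‖ψ x‖ ≤ B) (hB' : ∀ x, ‖ψ' x‖ ≤ B')
    (hC : ∀ x, ‖ψ x - ψ' x‖ ≤ C) :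
    |(∫ x, inner ℝ (ψ x) (u x) ∂m) - ∫ x in (Ω : Set (Space d)), inner ℝ (ψ' x) (u x) ∂m|
      ≤ C * ∫ x in (Ω : Set (Space d)), ‖u x‖ ∂m := by
  have hi := (integrable_inner_of_bound hu hψ.aestronglyMeasurable hB).integrableOn
    (s := (Ω : Set (Space d)))
  have hi' := (integrable_inner_of_bound hu hψ'.aestronglyMeasurable hB').integrableOn
    (s := (Ω : Set (Space d)))
  rw [← setIntegral_eq_integral_of_forall_compl_eq_zero (s := (Ω : Set (Space d)))
    (fun x hx => by rw [hψ0 x hx, inner_zero_left]), ← integral_sub hi hi', ← integral_const_mul,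
    ← Real.norm_eq_abs]
  refine norm_integral_le_of_norm_le (hu.norm.integrableOn.const_mul C)
    (.of_forall fun x => ?_)
  rw [← inner_sub_left]
  exact (norm_inner_le_norm _ _).trans (by gcongr; exact hC x)

variable {Ω}

theorem continuous_linearIntegrand {φ : Space d → ℝ} {a : Torus d → E} (hφ : Continuous φ)
    (ha : Continuous a) :
    Continuous fun q : Space d × Torus d × E => φ q.1 * inner ℝ (a q.2.1) q.2.2 := by
  fun_prop

theorem linearIntegrand_smul (φ : Space d → ℝ) (a : Torus d → E) (x : Space d) (ξ : Torus d)
    (z : E) (t : ℝ) (_ : 0 < t) :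
    φ x * inner ℝ (a ξ) (t • z) = t * (φ x * inner ℝ (a ξ) z) := by
  rw [inner_smul_right]
  ring

theorem scaledFunctional_linearIntegrand {φ : Space d → ℝ} {a : Torus d → E} (hφ : Continuous φ)
    (ha : Continuous a) (ε : ℝ) {μ : VectorMeasure (Space d) E} (D : LebesgueDecomposition μ) :
    scaledFunctional Ω (fun x ξ z => φ x * inner ℝ (a ξ) z) ε D
      = (∫ x in (Ω : Set (Space d)), inner ℝ (φ x • a (toTorus (ε⁻¹ • x))) (D.ac x))
        + ∫ x in (Ω : Set (Space d)), inner ℝ (φ x • a (toTorus (ε⁻¹ • x))) (D.polar x)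
          ∂D.singVar := by
  simp only [scaledFunctional, real_inner_smul_left]
  congr 1
  refine setIntegral_congr_fun Ω.isOpen.measurableSet fun x hx => ?_
  exact recession_eq_of_homogeneous (continuous_linearIntegrand hφ ha)
    (linearIntegrand_smul φ a) (subset_closure hx) _ _

theorem continuous_normIntegrand :
    Continuous fun q : Space d × Torus d × E => ‖q.2.2‖ := by fun_prop

theorem normIntegrand_smul (_ : Space d) (_ : Torus d) (z : E) (t : ℝ) (ht : 0 < t) :
    ‖t • z‖ = t * ‖z‖ := by
  rw [norm_smul, Real.norm_of_nonneg ht.le]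

/-- As the polar density has norm one, this is the mass of μ on Ω; generation thus controls the
masses of the sequence. -/
theorem scaledFunctional_norm (ε : ℝ) {μ : VectorMeasure (Space d) E}
    (D : LebesgueDecomposition μ) :
    scaledFunctional Ω (fun _ _ z => ‖z‖) ε D
      = (∫ x in (Ω : Set (Space d)), ‖D.ac x‖)
        + ∫ x in (Ω : Set (Space d)), ‖D.polar x‖ ∂D.singVar := by
  simp only [scaledFunctional]
  congr 1
  refine setIntegral_congr_fun Ω.isOpen.measurableSet fun x hx => ?_
  exact recession_eq_of_homogeneous continuous_normIntegrand normIntegrand_smul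
    (subset_closure hx) _ _

end LinearIntegrand

/-! ### Passing to the limit along the generating sequence -/

section Generation

variable {d k : ℕ} {E F : Type*}
    [NormedAddCommGroup E] [InnerProductSpace ℝ E] [FiniteDimensional ℝ E]
    [MeasurableSpace E] [BorelSpace E]
    [NormedAddCommGroup F] [InnerProductSpace ℝ F] [FiniteDimensional ℝ F]
    {A : (Fin d → ℕ) → E →ₗ[ℝ] F} {Ω : TopologicalSpace.Opens (Space d)}

theorem exists_abs_opMeasure_sub_scaledFunctional_le (k : ℕ) (A : (Fin d → ℕ) → E →ₗ[ℝ] F)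
    {φ : Space d → ℝ} {g : Space d → F}
    (hφ : ContDiff ℝ ∞ φ) (hφ' : HasCompactSupport φ) (hg : ContDiff ℝ ∞ g)
    (hg' : IsPeriodic g) :
    ∃ C, 0 ≤ C ∧ ∀ ε, 0 < ε → ε ≤ 1 → ∀ Ψ : 𝓓(Ω, F), ⇑Ψ = ε ^ k • oscillating φ g ε →
      ∀ (μ : VectorMeasure (Space d) E) (D : LebesgueDecomposition μ),
        |opMeasure k A Ω μ Ψ - scaledFunctional Ω
            (fun x ξ z => φ x * inner ℝ (adjointOp k A g (torusRep ξ)) z) ε D|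
          ≤ C * ε * scaledFunctional Ω (fun _ _ z => ‖z‖) ε D := by
  obtain ⟨C, h0, hC⟩ := exists_bound_adjointOp_oscillating_sub k A hφ hφ' hg hg'
  refine ⟨C, h0, fun ε hε hε1 Ψ hΨ μ D => ?_⟩
  have hgA := hg'.adjointOp k A
  have hcA := continuous_adjointOp k A hg
  have ha := hgA.continuous_comp_torusRep hcA
  obtain ⟨B', -, hB'⟩ := exists_bound_oscillating hφ.continuous hφ' hcA hgA
  have hψc : Continuous (adjointOp k A Ψ) := continuous_adjointOp k A Ψ.contDiff
  have hψ0 : ∀ x ∉ Ω, adjointOp k A Ψ x = 0 := fun x hx =>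
    adjointOp_eq_zero_of_notMem_tsupport k A fun h => hx (Ψ.tsupport_subset h)
  have hsub : ∀ x, ‖adjointOp k A Ψ x - oscillating φ (adjointOp k A g) ε x‖ ≤ C * ε := fun x => by
    rw [hΨ]
    exact hC ε hε hε1 x
  have hB : ∀ x, ‖adjointOp k A Ψ x‖ ≤ C * ε + B' := fun x => by
    have := norm_add_le (adjointOp k A Ψ x - oscillating φ (adjointOp k A g) ε x)
      (oscillating φ (adjointOp k A g) ε x)
    rw [sub_add_cancel] at this
    exact this.trans (add_le_add (hsub x) (hB' ε x))
  have hoc : Continuous (oscillating φ (adjointOp k A g) ε) :=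
    hφ.continuous.smul (hcA.comp (continuous_const_smul _))
  have h1 : opMeasure k A Ω μ Ψ = (∫ x, inner ℝ (adjointOp k A Ψ x) (D.ac x))
      + ∫ x, inner ℝ (adjointOp k A Ψ x) (D.polar x) ∂D.singVar := by
    conv_lhs => rw [opMeasure, D.eq_add]
    exact pairing_add_withDensityᵥ D.integrable_ac D.integrable_polar hψc.stronglyMeasurable hB
  rw [h1, scaledFunctional_linearIntegrand hφ.continuous ha, scaledFunctional_norm]
  simp only [hgA.apply_torusRep_toTorus]
  have h2 := abs_integral_inner_sub_setIntegral_inner_le Ω D.integrable_ac hψc hoc hψ0 hB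
    (hB' ε) hsub
  have h3 := abs_integral_inner_sub_setIntegral_inner_le Ω D.integrable_polar hψc hoc hψ0 hB
    (hB' ε) hsub
  rw [add_sub_add_comm, mul_add]
  exact (abs_add_le _ _).trans (add_le_add h2 h3)

/-- By linearity: M⁻¹Ψ is admissible in the supremum. -/
theorem enorm_opMeasure_le_mul_negSobolevNorm (p : ℝ) {M : ℝ} (hM : 0 < M) (Ψ : 𝓓(Ω, F))
    (hΨ : sobolevNorm k (ENNReal.ofReal (p / (p - 1))) Ω Ψ ≤ ENNReal.ofReal M)
    (μ : VectorMeasure (Space d) E) :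
    ‖opMeasure k A Ω μ Ψ‖ₑ ≤ ENNReal.ofReal M * negSobolevNorm k p Ω (opMeasure k A Ω μ) := by
  have hcoe : ⇑(M⁻¹ • Ψ) = M⁻¹ • ⇑Ψ := rfl
  have h1 : sobolevNorm k (ENNReal.ofReal (p / (p - 1))) Ω (M⁻¹ • Ψ) ≤ 1 := by
    have : sobolevNorm k (ENNReal.ofReal (p / (p - 1))) Ω (M⁻¹ • Ψ)
        = ‖M⁻¹‖ₑ * sobolevNorm k (ENNReal.ofReal (p / (p - 1))) Ω Ψ := by
      simp only [sobolevNorm, hcoe, multiDeriv_smul _ _ Ψ.contDiff, eLpNorm_const_smul,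
        Finset.mul_sum]
    rw [this, Real.enorm_of_nonneg (by positivity)]
    calc _ ≤ ENNReal.ofReal M⁻¹ * ENNReal.ofReal M := by gcongr
      _ = 1 := by rw [← ENNReal.ofReal_mul (by positivity), inv_mul_cancel₀ hM.ne',
        ENNReal.ofReal_one]
  have h2 : opMeasure k A Ω μ Ψ = M * opMeasure k A Ω μ (M⁻¹ • Ψ) := by
    simp only [opMeasure, hcoe, adjointOp_smul k A _ Ψ.contDiff, pairing_smul_left]
    field_simp
  rw [h2, enorm_mul, Real.enorm_of_nonneg hM.le]
  gcongr
  exact le_iSup₂_of_le (M⁻¹ • Ψ) h1 le_rfl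

/-- The duality product of an `𝒜`-free Young measure with `φ ⊗ 𝒜^*g ⊗ id` vanishes. -/
theorem YoungMeasure.IsAFree.dual_eq_zero (hΩ : Bornology.IsBounded (Ω : Set (Space d)))
    {p : ℝ} {ν : YoungMeasure Ω E} (hν : ν.IsAFree k A p)
    {φ : Space d → ℝ} {g : Space d → F}
    (hφ : ContDiff ℝ ∞ φ) (hφ' : HasCompactSupport φ) (hφΩ : tsupport φ ⊆ Ω)
    (hg : ContDiff ℝ ∞ g) (hg' : IsPeriodic g) :
    ν.dual (fun x ξ z => φ x * inner ℝ (adjointOp k A g (torusRep ξ)) z) = 0 := by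
  obtain ⟨ε, μ, hε, hε0, -, hneg, D, hD⟩ := hν
  have ha := (hg'.adjointOp k A).continuous_comp_torusRep (continuous_adjointOp k A hg)
  have hI := hD _ (isIntegrand_of_homogeneous (Ω := Ω)
    (f := fun x ξ z => φ x * inner ℝ (adjointOp k A g (torusRep ξ)) z)
    (continuous_linearIntegrand hφ.continuous ha) (linearIntegrand_smul φ _))
  have hN := hD _ (isIntegrand_of_homogeneous (Ω := Ω) (E := E)
    continuous_normIntegrand normIntegrand_smul)
  obtain ⟨C, h0, hC⟩ := exists_abs_opMeasure_sub_scaledFunctional_le (Ω := Ω) k A hφ hφ' hg hg'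
  obtain ⟨M, hM, hMb⟩ := exists_sobolevNorm_oscillating_le hΩ k (ENNReal.ofReal (p / (p - 1)))
    hφ hφ' hg hg'
  have hsupp : ∀ j, Function.support (ε j ^ k • oscillating φ g (ε j)) ⊆ tsupport φ := by
    intro j x hx
    by_contra h
    simp [oscillating, image_eq_zero_of_notMem_tsupport h] at hx
  let Ψ : ℕ → 𝓓(Ω, F) := fun j =>
    ⟨ε j ^ k • oscillating φ g (ε j), contDiff_const.smul (contDiff_oscillating hφ hg (ε j)),
      hφ'.mono' (hsupp j), (closure_minimal (hsupp j) (isClosed_tsupport φ)).trans hφΩ⟩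
  have hε1 : ∀ᶠ j in atTop, ε j ≤ 1 := hε0.eventually_le_const one_pos
  have hT : Tendsto (fun j => opMeasure k A Ω (μ j) (Ψ j)) atTop (𝓝 0) := by
    refine tendsto_zero_iff_enorm_tendsto_zero.2 ?_
    have hlim : Tendsto (fun j => ENNReal.ofReal M * negSobolevNorm k p Ω (opMeasure k A Ω (μ j)))
        atTop (𝓝 0) := by
      simpa using ENNReal.Tendsto.const_mul hneg (.inr ENNReal.ofReal_ne_top)
    refine tendsto_of_tendsto_of_tendsto_of_le_of_le' tendsto_const_nhds hlim
      (.of_forall fun _ => zero_le) ?_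
    filter_upwards [hε1] with j hj
    exact enorm_opMeasure_le_mul_negSobolevNorm p hM (Ψ j) (hMb (ε j) (hε j) hj (Ψ j) rfl) (μ j)
  have hdiff : Tendsto (fun j => opMeasure k A Ω (μ j) (Ψ j) - scaledFunctional Ω
      (fun x ξ z => φ x * inner ℝ (adjointOp k A g (torusRep ξ)) z) (ε j) (D j)) atTop (𝓝 0) := by
    have hlim : Tendsto (fun j => C * ε j * scaledFunctional Ω (fun _ _ z => ‖z‖) (ε j) (D j))
        atTop (𝓝 0) := by
      -- The factor ε_j tends to 0, while the masses converge to a finite limit.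
      simpa using (hε0.const_mul C).mul hN
    refine squeeze_zero_norm' ?_ hlim
    filter_upwards [hε1] with j hj
    exact hC (ε j) (hε j) hj (Ψ j) rfl (μ j) (D j)
  -- T_j - (T_j - I_j) = I_j, so the functionals I_j of the integrand tend to 0.
  have := hT.sub hdiff
  simp only [sub_sub_cancel, sub_zero] at this
  exact tendsto_nhds_unique hI this

end Generation

/-! ### Vector measures of finite variation as continuous functionals -/

section FiniteVariation

variable {X E : Type*} [MeasurableSpace X] [NormedAddCommGroup E] [InnerProductSpace ℝ E]

/-- Without integrability `withDensityᵥ` is zero by definition. This gives finite variation of the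
barycenter at every point, not just almost everywhere. -/
theorem isFiniteMeasure_variation_withDensityᵥ' [CompleteSpace E] (m : Measure X) (u : X → E) :
    IsFiniteMeasure (m.withDensityᵥ u).variation := by
  by_cases hu : Integrable u m
  · exact isFiniteMeasure_variation_withDensityᵥ hu
  · rw [Measure.withDensityᵥ, dif_neg hu, VectorMeasure.variation_zero]
    infer_instance

/-- The pairing is Lipschitz in the uniform norm, with constant controlled by the total variation.
-/
theorem continuous_pairing [TopologicalSpace X] [CompactSpace X] [BorelSpace X]
    [SecondCountableTopology E] (η : VectorMeasure X E) [IsFiniteMeasure η.variation] :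
    Continuous fun a : C(X, E) => pairing a η := by
  have hint : ∀ a : C(X, E), η.Integrable a := fun a => by
    borelize E
    exact (integrable_const ‖a‖).mono' a.continuous.measurable.aestronglyMeasurable
      (.of_forall a.norm_coe_le_norm)
  refine (LipschitzWith.of_dist_le' (K := ‖innerSL ℝ (E := E)‖ * η.variation.real univ)
    fun a b => ?_).continuous
  have h : pairing a η - pairing b η = η.integral (a - b : C(X, E)) (innerSL ℝ) :=
    (VectorMeasure.integral_sub (hint a) (hint b)).symm
  rw [dist_eq_norm, h, dist_eq_norm]
  refine (VectorMeasure.norm_integral_le_of_norm_le_const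
    (.of_forall (a - b).norm_coe_le_norm)).trans_eq (by ring)

/-- The exceptional set can be chosen independently of the test function, as `C(X, E)` is
separable. -/
theorem ae_forall_pairing_eq_zero [TopologicalSpace X] [CompactSpace X] [T2Space X] [BorelSpace X]
    [SecondCountableTopology X] [SecondCountableTopology E] {Y : Type*} [MeasurableSpace Y]
    {m : Measure Y} {η : Y → VectorMeasure X E} (hη : ∀ y, IsFiniteMeasure (η y).variation)
    {𝒢 : Set C(X, E)} (h : ∀ a ∈ 𝒢, ∀ᵐ y ∂m, pairing a (η y) = 0) :
    ∀ᵐ y ∂m, ∀ a ∈ 𝒢, pairing a (η y) = 0 := by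
  obtain ⟨D, hD𝒢, hDc, hD⟩ :=
    (TopologicalSpace.IsSeparable.of_separableSpace 𝒢).exists_countable_dense_subset
  filter_upwards [(ae_ball_iff hDc).2 fun a ha => h a (hD𝒢 ha)] with y hy a ha
  have := hη y
  have hclosed : IsClosed {a : C(X, E) | pairing a (η y) = 0} :=
    isClosed_eq (continuous_pairing _) continuous_const
  exact closure_minimal hy hclosed (hD ha)

end FiniteVariation

/-! ### The barycenter as a density with respect to ℒ^d + λ^s -/

namespace YoungMeasure

variable {d : ℕ} {Ω : TopologicalSpace.Opens (Space d)} {E : Type*}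
  [NormedAddCommGroup E] [InnerProductSpace ℝ E] [FiniteDimensional ℝ E]
  [MeasurableSpace E] [BorelSpace E] (ν : YoungMeasure Ω E)

instance : IsMarkovKernel ν.osc := ν.markov_osc
instance : IsMarkovKernel ν.rho := ν.markov_rho
instance : IsMarkovKernel ν.oscInf := ν.markov_oscInf
instance : IsFiniteMeasure ν.conc := ν.finite_conc

/-- The barycenter `⟨id, ν_{x,ξ}⟩`. -/
def oscBary (q : Space d × Torus d) : E := ∫ z, z ∂(ν.osc q)

/-- The barycenter `⟨id, ν^∞_{x,ξ}⟩`. -/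
def infBary (q : Space d × Torus d) : E := ∫ z, z ∂(ν.oscInf q)

theorem stronglyMeasurable_oscBary : StronglyMeasurable ν.oscBary :=
  stronglyMeasurable_id.integral_kernel

theorem stronglyMeasurable_infBary : StronglyMeasurable ν.infBary :=
  stronglyMeasurable_id.integral_kernel

theorem integrable_oscBary : Integrable ν.oscBary
    ((volume.restrict (closure (Ω : Set (Space d)))).prod (volume : Measure (Torus d))) :=
  ⟨ν.stronglyMeasurable_oscBary.aestronglyMeasurable,
    (lintegral_mono fun _ => enorm_integral_le_lintegral_enorm _).trans_lt ν.moment_osc⟩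

theorem ae_integrable_osc : ∀ᵐ q ∂((volume.restrict (closure (Ω : Set (Space d)))).prod
    (volume : Measure (Torus d))), Integrable (fun z => z) (ν.osc q) := by
  filter_upwards [ae_lt_top (measurable_enorm.lintegral_kernel) ν.moment_osc.ne] with q hq
  exact ⟨aestronglyMeasurable_id, hq⟩

theorem ae_norm_le_oscInf : ∀ᵐ q ∂(ν.conc ⊗ₘ ν.rho), ∀ᵐ z ∂(ν.oscInf q), ‖z‖ ≤ 1 := by
  filter_upwards [ν.oscInf_sphere] with q hq
  have : ∀ᵐ z ∂(ν.oscInf q), z ∈ Metric.sphere (0 : E) 1 := hq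
  filter_upwards [this] with z hz
  simpa using (mem_sphere_zero_iff_norm.1 hz).le

theorem ae_integrable_oscInf :
    ∀ᵐ q ∂(ν.conc ⊗ₘ ν.rho), Integrable (fun z => z) (ν.oscInf q) := by
  filter_upwards [ν.ae_norm_le_oscInf] with q hq
  exact (integrable_const (1 : ℝ)).mono' aestronglyMeasurable_id hq

theorem ae_norm_infBary_le : ∀ᵐ q ∂(ν.conc ⊗ₘ ν.rho), ‖ν.infBary q‖ ≤ 1 := by
  filter_upwards [ν.ae_norm_le_oscInf] with q hq
  simpa [infBary] using norm_integral_le_of_norm_le_const hq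

theorem ae_integrable_infBary :
    ∀ᵐ x ∂ν.conc, Integrable (fun ξ => ν.infBary (x, ξ)) (ν.rho x) := by
  filter_upwards [Measure.ae_ae_of_ae_compProd ν.ae_norm_infBary_le] with x hx
  exact (integrable_const (1 : ℝ)).mono'
    (ν.stronglyMeasurable_infBary.comp_measurable measurable_prodMk_left).aestronglyMeasurable hx

/-- The pairing of the oscillation part of the barycenter with `a`. -/
def oscPairing (a : Torus d → E) (x : Space d) : ℝ := ∫ ξ : Torus d, inner ℝ (a ξ) (ν.oscBary (x, ξ))

/-- The pairing of the concentration part of the barycenter with `a`. -/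
def infPairing (a : Torus d → E) (x : Space d) : ℝ := ∫ ξ, inner ℝ (a ξ) (ν.infBary (x, ξ)) ∂(ν.rho x)

variable {a : Torus d → E} (ha : Continuous a) {C : ℝ} (hC : ∀ ξ, ‖a ξ‖ ≤ C)

include ha hC

theorem integrableOn_oscPairing : IntegrableOn (ν.oscPairing a) (closure (Ω : Set (Space d))) :=
  have h : Integrable (fun q : Space d × Torus d => inner ℝ (a q.2) (ν.oscBary q))
      ((volume.restrict (closure (Ω : Set (Space d)))).prod volume) :=
    integrable_inner_of_bound ν.integrable_oscBary
      (ha.comp continuous_snd).aestronglyMeasurable fun q => hC q.2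
  h.integral_prod_left

theorem integrable_infPairing : Integrable (ν.infPairing a) ν.conc := by
  have h : StronglyMeasurable fun q : Space d × Torus d => inner ℝ (a q.2) (ν.infBary q) :=
    (ha.comp continuous_snd).stronglyMeasurable.inner ν.stronglyMeasurable_infBary
  refine (integrable_const C).mono' h.integral_kernel_prod_right'.aestronglyMeasurable ?_
  filter_upwards [Measure.ae_ae_of_ae_compProd ν.ae_norm_infBary_le] with x hx
  have := norm_integral_le_of_norm_le_const (μ := ν.rho x) (C := C)
    (f := fun ξ => inner ℝ (a ξ) (ν.infBary (x, ξ))) ?_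
  · simpa [infPairing] using this
  filter_upwards [hx] with ξ hξ
  refine (norm_inner_le_norm _ _).trans ?_
  exact (mul_le_of_le_one_right (norm_nonneg _) hξ).trans (hC ξ)

omit ha hC in
theorem ae_oscPairing_eq (a : Torus d → E) :
    ∀ᵐ x ∂volume.restrict (closure (Ω : Set (Space d))),
      ∫ ξ : Torus d, ∫ z, inner ℝ (a ξ) z ∂(ν.osc (x, ξ)) = ν.oscPairing a x := by
  filter_upwards [Measure.ae_ae_of_ae_prod ν.ae_integrable_osc] with x hx
  refine integral_congr_ae ?_
  filter_upwards [hx] with ξ hξ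
  exact integral_inner hξ (a ξ)

omit ha hC in
theorem ae_infPairing_eq (a : Torus d → E) :
    ∀ᵐ x ∂ν.conc,
      ∫ ξ, ∫ z, inner ℝ (a ξ) z ∂(ν.oscInf (x, ξ)) ∂(ν.rho x) = ν.infPairing a x := by
  filter_upwards [Measure.ae_ae_of_ae_compProd ν.ae_integrable_oscInf] with x hx
  refine integral_congr_ae ?_
  filter_upwards [hx] with ξ hξ
  exact integral_inner hξ (a ξ)

omit hC in
theorem dual_linearIntegrand {φ : Space d → ℝ} (hφ : Continuous φ) (hφΩ : tsupport φ ⊆ Ω) :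
    ν.dual (fun x ξ z => φ x * inner ℝ (a ξ) z)
      = (∫ x in (Ω : Set (Space d)), φ x * ν.oscPairing a x)
        + ∫ x in (Ω : Set (Space d)), φ x * ν.infPairing a x ∂ν.conc := by
  have hcl : ν.conc.restrict (closure (Ω : Set (Space d))) = ν.conc :=
    Measure.restrict_eq_self_of_ae_mem (mem_ae_iff.2 ν.conc_support)
  rw [dual]
  congr 1
  · refine integral_congr_ae ?_
    filter_upwards [ae_restrict_of_ae_restrict_of_subset subset_closure (ν.ae_oscPairing_eq a)]
      with x hx
    simp only [integral_const_mul, hx]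
  -- φ vanishes off Ω and λ is carried by the closure of Ω, so both sides become integrals over the
  -- whole space.
  · rw [setIntegral_eq_integral_of_forall_compl_eq_zero (s := (Ω : Set (Space d)))
      fun x hx => by rw [image_eq_zero_of_notMem_tsupport fun h => hx (hφΩ h), zero_mul]]
    have h1 : ∀ x ∈ closure (Ω : Set (Space d)),
        (∫ ξ, ∫ z, recession Ω (fun x ξ z => φ x * inner ℝ (a ξ) z) x ξ z ∂(ν.oscInf (x, ξ))
          ∂(ν.rho x)) = φ x * ∫ ξ, ∫ z, inner ℝ (a ξ) z ∂(ν.oscInf (x, ξ)) ∂(ν.rho x) := by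
      intro x hx
      simp only [recession_eq_of_homogeneous (f := fun x ξ z => φ x * inner ℝ (a ξ) z)
        (continuous_linearIntegrand hφ ha) (linearIntegrand_smul φ a) hx, integral_const_mul]
    rw [setIntegral_congr_fun isClosed_closure.measurableSet h1, hcl]
    refine integral_congr_ae ?_
    filter_upwards [ν.ae_infPairing_eq a] with x hx
    rw [hx]

omit ha hC in
/-- A `λ`-a.e. property holds `ℒ^d`-a.e. where `λ^{ac}` does not vanish. -/
theorem ae_rnDeriv_ne_zero {P : Space d → Prop} (h : ∀ᵐ x ∂ν.conc, P x) :
    ∀ᵐ x, ν.conc.rnDeriv volume x ≠ 0 → P x :=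
  (ae_withDensity_iff (Measure.measurable_rnDeriv _ _)).1
    ((Measure.absolutelyContinuous_of_le (Measure.withDensity_rnDeriv_le _ _)).ae_le h)

open Classical in
/-- The pairing of the second-scale barycenter with `a`, as a function of the macroscopic point. -/
def baryPairing (S : Set (Space d)) (a : Torus d → E) (x : Space d) : ℝ :=
  if x ∈ S then ν.infPairing a x
  else ν.oscPairing a x + (ν.conc.rnDeriv volume x).toReal * ν.infPairing a x

variable {S : Set (Space d)} (hS : ν.IsSingularSet S)

omit ha hC [FiniteDimensional ℝ E] in
include hS in
theorem IsSingularSet.ae_notMem : ∀ᵐ x, x ∉ S := measure_eq_zero_iff_ae_notMem.1 hS.volume_eq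

omit ha hC [FiniteDimensional ℝ E] in
include hS in
theorem IsSingularSet.ae_mem : ∀ᵐ x ∂ν.concSing.restrict (Ω : Set (Space d)), x ∈ S := by
  rw [ae_restrict_iff' Ω.isOpen.measurableSet]
  filter_upwards [measure_eq_zero_iff_ae_notMem.1 hS.concSing_eq] with x hx hxΩ
  by_contra h
  exact hx ⟨subset_closure hxΩ, h⟩

include hS in
theorem ae_pairing_secondBarycenter :
    ∀ᵐ x ∂((volume + ν.concSing).restrict (Ω : Set (Space d))),
      pairing a (ν.secondBarycenter S x) = ν.baryPairing S a x := by
  have hsm := ha.stronglyMeasurable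
  rw [Measure.restrict_add, ae_add_measure_iff]
  constructor
  · have h1 : ∀ᵐ x ∂volume.restrict (closure (Ω : Set (Space d))),
        Integrable (fun ξ => ν.oscBary (x, ξ)) := ν.integrable_oscBary.prod_right_ae
    filter_upwards [ae_restrict_of_ae_restrict_of_subset subset_closure h1,
      ae_restrict_of_ae hS.ae_notMem,
      ae_restrict_of_ae (ν.ae_rnDeriv_ne_zero ν.ae_integrable_infBary)] with x hx hxS hx'
    rw [secondBarycenter, baryPairing, if_neg hxS, if_neg hxS]
    -- Integrability of `infBary` is known only λ-a.e., hence Lebesgue-a.e. only where λ^{ac} is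
    -- nonzero; elsewhere the concentration term has coefficient 0.
    by_cases h0 : ν.conc.rnDeriv volume x = 0
    · simp only [h0, ENNReal.toReal_zero, zero_smul, add_zero, zero_mul]
      exact pairing_withDensityᵥ hx hsm hC
    · rw [← withDensityᵥ_smul]
      refine (pairing_add_withDensityᵥ hx ((hx' h0).smul _) hsm hC).trans ?_
      simp only [inner_smul_right, integral_const_mul, Pi.smul_apply]
      rfl
  · have h1 : ∀ᵐ x ∂ν.concSing, Integrable (fun ξ => ν.infBary (x, ξ)) (ν.rho x) :=
      (Measure.absolutelyContinuous_of_le (Measure.singularPart_le _ _)).ae_le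
        ν.ae_integrable_infBary
    filter_upwards [ae_restrict_of_ae h1, hS.ae_mem] with x hx hxS
    rw [secondBarycenter, baryPairing, if_pos hxS, if_pos hxS]
    exact pairing_withDensityᵥ hx hsm hC

omit ha hC [FiniteDimensional ℝ E] in
include hS in
theorem baryPairing_ae_eq_volume : ν.baryPairing S a =ᵐ[volume.restrict (Ω : Set (Space d))]
    fun x => ν.oscPairing a x + (ν.conc.rnDeriv volume x).toReal * ν.infPairing a x := by
  filter_upwards [ae_restrict_of_ae hS.ae_notMem] with x hx
  rw [baryPairing, if_neg hx]

omit ha hC [FiniteDimensional ℝ E] in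
include hS in
theorem baryPairing_ae_eq_concSing :
    ν.baryPairing S a =ᵐ[ν.concSing.restrict (Ω : Set (Space d))] ν.infPairing a := by
  filter_upwards [hS.ae_mem] with x hx
  rw [baryPairing, if_pos hx]

omit ha hC [FiniteDimensional ℝ E] in
theorem integrable_rnDeriv_mul {f : Space d → ℝ} (hf : Integrable f ν.conc) :
    Integrable fun x => (ν.conc.rnDeriv volume x).toReal * f x :=
  (integrable_withDensity_iff_integrable_smul' (Measure.measurable_rnDeriv _ _)
    (Measure.rnDeriv_lt_top _ _)).1 (hf.mono_measure (Measure.withDensity_rnDeriv_le _ _))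

omit ha hC [FiniteDimensional ℝ E] in
theorem setIntegral_conc {f : Space d → ℝ} (hf : Integrable f ν.conc) :
    ∫ x in (Ω : Set (Space d)), f x ∂ν.conc
      = (∫ x in (Ω : Set (Space d)), f x ∂ν.concSing)
        + ∫ x in (Ω : Set (Space d)), (ν.conc.rnDeriv volume x).toReal * f x := by
  have h1 : IntegrableOn f (Ω : Set (Space d)) (ν.conc.singularPart volume) :=
    (hf.mono_measure (Measure.singularPart_le _ _)).integrableOn
  have h2 : IntegrableOn f (Ω : Set (Space d)) (volume.withDensity (ν.conc.rnDeriv volume)) :=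
    (hf.mono_measure (Measure.withDensity_rnDeriv_le _ _)).integrableOn
  conv_lhs => rw [Measure.haveLebesgueDecomposition_add ν.conc volume]
  rw [Measure.restrict_add, concSing, integral_add_measure h1 h2,
    setIntegral_withDensity_eq_setIntegral_toReal_smul (Measure.measurable_rnDeriv _ _)
      (ae_restrict_of_ae (Measure.rnDeriv_lt_top _ _)) _ Ω.isOpen.measurableSet]
  rfl

include hS in
theorem integrableOn_baryPairing :
    IntegrableOn (ν.baryPairing S a) (Ω : Set (Space d)) (volume + ν.concSing) := by
  rw [integrableOn_add_measure]
  refine ⟨Integrable.congr ?_ (ν.baryPairing_ae_eq_volume hS).symm,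
    Integrable.congr ?_ (ν.baryPairing_ae_eq_concSing hS).symm⟩
  · exact ((ν.integrableOn_oscPairing ha hC).mono_set subset_closure).add
      (ν.integrable_rnDeriv_mul (ν.integrable_infPairing ha hC)).integrableOn
  · exact ((ν.integrable_infPairing ha hC).mono_measure
      (Measure.singularPart_le _ _)).integrableOn

include hS in
-- Splitting λ into λ^{ac} and λ^s sends its first part to the Lebesgue integral. The two branches
-- of `baryPairing` then match, because S is Lebesgue null and carries λ^s inside Ω.
theorem integral_mul_baryPairing {φ : Space d → ℝ} (hφ : Continuous φ)
    (hφ' : HasCompactSupport φ) (hφΩ : tsupport φ ⊆ Ω) :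
    ∫ x, φ x * ν.baryPairing S a x ∂(volume + ν.concSing)
      = ν.dual (fun x ξ z => φ x * inner ℝ (a ξ) z) := by
  obtain ⟨B, hB⟩ := hφ.bounded_above_of_compact_support hφ'
  have hmul : ∀ {m : Measure (Space d)} {f : Space d → ℝ}, Integrable f m →
      Integrable (fun x => φ x * f x) m := fun hf =>
    hf.bdd_mul hφ.aestronglyMeasurable (.of_forall hB)
  have hb := ν.integrableOn_baryPairing ha hC hS
  rw [integrableOn_add_measure] at hb
  have hinf := ν.integrable_infPairing ha hC
  rw [ν.dual_linearIntegrand ha hφ hφΩ, ν.setIntegral_conc (hmul hinf),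
    ← setIntegral_eq_integral_of_forall_compl_eq_zero (s := (Ω : Set (Space d)))
      (fun x hx => by rw [image_eq_zero_of_notMem_tsupport fun h => hx (hφΩ h), zero_mul]),
    Measure.restrict_add, integral_add_measure (hmul hb.1) (hmul hb.2)]
  have h1 : ∫ x in (Ω : Set (Space d)), φ x * ν.baryPairing S a x
      = (∫ x in (Ω : Set (Space d)), φ x * ν.oscPairing a x)
        + ∫ x in (Ω : Set (Space d)), (ν.conc.rnDeriv volume x).toReal
            * (φ x * ν.infPairing a x) := by
    rw [← integral_add (hmul ((ν.integrableOn_oscPairing ha hC).mono_set subset_closure))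
      (ν.integrable_rnDeriv_mul (hmul hinf)).integrableOn]
    refine integral_congr_ae ?_
    filter_upwards [ν.baryPairing_ae_eq_volume (a := a) hS] with x hx
    rw [hx]
    ring
  have h2 : ∫ x in (Ω : Set (Space d)), φ x * ν.baryPairing S a x ∂ν.concSing
      = ∫ x in (Ω : Set (Space d)), φ x * ν.infPairing a x ∂ν.concSing := by
    refine integral_congr_ae ?_
    filter_upwards [ν.baryPairing_ae_eq_concSing (a := a) hS] with x hx
    rw [hx]
  rw [h1, h2]
  ring

include hS in
-- The fundamental lemma of the calculus of variations on Ω, for the measure ℒ^d + λ^s.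
theorem ae_pairing_secondBarycenter_eq_zero
    (hdual : ∀ φ : Space d → ℝ, ContDiff ℝ ∞ φ → HasCompactSupport φ → tsupport φ ⊆ Ω →
      ν.dual (fun x ξ z => φ x * inner ℝ (a ξ) z) = 0) :
    ∀ᵐ x ∂((volume + ν.concSing).restrict (Ω : Set (Space d))),
      pairing a (ν.secondBarycenter S x) = 0 := by
  have h := Ω.isOpen.ae_eq_zero_of_integral_contDiff_smul_eq_zero
    (ν.integrableOn_baryPairing ha hC hS).locallyIntegrableOn fun φ hφ hφ' hφΩ =>
      (ν.integral_mul_baryPairing ha hC hS hφ.continuous hφ' hφΩ).trans (hdual φ hφ hφ' hφΩ)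
  filter_upwards [ν.ae_pairing_secondBarycenter ha hC hS,
    (ae_restrict_iff' Ω.isOpen.measurableSet).2 h] with x hx hx'
  rw [hx, hx']

omit ha hC in
theorem isFiniteMeasure_variation_secondBarycenter (S : Set (Space d)) (x : Space d) :
    IsFiniteMeasure (ν.secondBarycenter S x).variation := by
  rw [secondBarycenter]
  split_ifs
  · exact isFiniteMeasure_variation_withDensityᵥ' _ _
  · rw [← withDensityᵥ_smul]
    have := isFiniteMeasure_variation_withDensityᵥ' (volume : Measure (Torus d))
      fun ξ => ∫ z, z ∂(ν.osc (x, ξ))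
    have := isFiniteMeasure_variation_withDensityᵥ' (ν.rho x)
      ((ν.conc.rnDeriv volume x).toReal • fun ξ => ∫ z, z ∂(ν.oscInf (x, ξ)))
    exact isFiniteMeasure_of_le _ VectorMeasure.variation_add_le

end YoungMeasure

end TwoScale

end

theorem proposition5p2 {d k : ℕ} (hd : 0 < d) {E F : Type*}
    [NormedAddCommGroup E] [InnerProductSpace ℝ E] [FiniteDimensional ℝ E]
    [MeasurableSpace E] [BorelSpace E]
    [NormedAddCommGroup F] [InnerProductSpace ℝ F] [FiniteDimensional ℝ F]
    (A : (Fin d → ℕ) → E →ₗ[ℝ] F)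
    (Ω : TopologicalSpace.Opens (TwoScale.Space d))
    (hΩ : Bornology.IsBounded (Ω : Set (TwoScale.Space d)))
    (hΩ' : volume (frontier (Ω : Set (TwoScale.Space d))) = 0)
    (p : ℝ) (hp : 1 < p) (hp' : p * ((d : ℝ) - 1) < d)
    (ν : TwoScale.YoungMeasure Ω E) (hν : ν.IsAFree k A p)
    (S : Set (TwoScale.Space d)) (hS : ν.IsSingularSet S) :
    ∀ᵐ x₀ ∂((volume + ν.concSing).restrict (Ω : Set (TwoScale.Space d))),
      TwoScale.IsAFreeOnTorus k A (ν.secondBarycenter S x₀) 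
:= by
  -- The functions 𝒜^*g on the torus form a subset of the separable space C(Z;E), so countably many
  -- of them suffice.
  let 𝒢 : Set C(TwoScale.Torus d, E) := {a | ∃ g : TwoScale.Space d → F, ContDiff ℝ ∞ g ∧
    TwoScale.IsPeriodic g ∧ ∀ ξ, a ξ = TwoScale.adjointOp k A g (TwoScale.torusRep ξ)}
  have hae : ∀ a ∈ 𝒢, ∀ᵐ x₀ ∂((volume + ν.concSing).restrict (Ω : Set (TwoScale.Space d))),
      TwoScale.pairing a (ν.secondBarycenter S x₀) = 0 := by
    rintro a ⟨g, hg, hg', hag⟩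
    refine ν.ae_pairing_secondBarycenter_eq_zero a.continuous a.norm_coe_le_norm hS
      fun φ hφ hφ' hφΩ => ?_
    simp only [hag]
    exact hν.dual_eq_zero hΩ hφ hφ' hφΩ hg hg'
  filter_upwards [TwoScale.ae_forall_pairing_eq_zero
    (ν.isFiniteMeasure_variation_secondBarycenter S) hae] with x₀ hx₀ g hg hg'
  exact hx₀ ⟨_, (hg'.adjointOp k A).continuous_comp_torusRep
    (TwoScale.continuous_adjointOp k A hg)⟩ ⟨g, hg, hg', fun _ => rfl⟩
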